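/- Let $\mathbb{G}$ be a Carnot group, that is, a connected and simply connected nilpotent Lie group whose (finite-dimensional, real) Lie algebra has a stratification $\mathfrak{g}=\mathfrak{v}_1\oplus\cdots\oplus\mathfrak{v}_s$ with $s\ge 1$, non-zero subspaces $\mathfrak{v}_i$, $[\mathfrak{v}_1,\mathfrak{v}_i]=\mathfrak{v}_{i+1}$ for $1\le i<s$ and $[\mathfrak{v}_1,\mathfrak{v}_s]=\{0\}$. Identify $\mathbb{G}$ with $\mathfrak{g}$ by the exponential map, so that the group law is given by the Baker–Campbell–Hausdorff formula. For $t>0$ let $\delta_t$ be the linear map with $\delta_t(U)=t^iU$ for $U\in\mathfrak{v}_i$, and let $Q=\sum_{i=1}^s i\dim\mathfrak{v}_i$ be the homogeneous dimension. Let $\|\cdot\|:\mathbb{G}\to[0,\infty)$ be a homogeneous norm, i.e. a continuous function with $\|\delta_t(p)\|=t\|p\|$ for all $t>0$ and $p\in\mathbb{G}$, and with $\|p\|=0$ if and only if $p=0$. Put $d(p,q)=\|q^{-1}\cdot p\|$, and let $\mathcal{H}^{Q-1}$ be the $(Q-1)$-dimensional Hausdorff measure defined with $d$. Let $X_1,\dots,X_m$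 be a basis of $\mathfrak{v}_1$, regarded as left-invariant vector fields on $\mathbb{G}$, and write $\nabla_{\mathbb{G}}f=\sum_{j=1}^m(X_jf)X_j$ for the horizontal gradient. Let $E\subset\mathbb{G}$ be a set of locally finite $(Q-1)$-dimensional measure: every point of $\mathbb{G}$ has a neighbourhood $U$ with $\mathcal{H}^{Q-1}(E\cap U)<\infty$. Let $f:\mathbb{G}\to\mathbb{R}$ be continuous. Suppose that $f\in C^1(\mathbb{G}\setminus E)$, in the sense that every point of $\mathbb{G}\setminus E$ has a neighbourhood in which $f$ is continuously differentiable, and that $\nabla_{\mathbb{G}}f\in L^\infty(\mathbb{G}\setminus E)$, in the sense that $|\nabla_{\mathbb{G}}f|$ is bounded by a constant at almost every point of $\mathbb{G}\setminus E$ with respect to Haar measure. Then $f$ is Lipschitz on $\mathbb{G}$: there is a constant $L$ such that $|f(p)-f(q)|\le L\,d(p,q)$ for all $p,q\in\mathbb{G}$. -/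

import Mathlib

open MeasureTheory Topology
open scoped ENNReal Nat

noncomputable section

/-- A Carnot group in exponential coordinates. A connected, simply connected nilpotent Lie group is
identified with its Lie algebra `E` by the exponential map, and its group law `CarnotGroup.mul` is
then the Baker-Campbell-Hausdorff product. The data is therefore a Lie bracket on the
finite-dimensional real vector space `E` and a stratification `E = 𝔳₁ ⊕ ⋯ ⊕ 𝔳ₛ` of it, where
`𝔳ᵢ = layer i`. The layers are indexed by `ℕ`, those outside `1, …, s` being zero. -/
structure CarnotGroup (E : Type*) [AddCommGroup E] [Module ℝ E] where
  /-- the Lie bracket `[x, y]` -/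
  bracket : E →ₗ[ℝ] E →ₗ[ℝ] E
  bracket_self : ∀ x, bracket x x = 0
  jacobi : ∀ x y z,
    bracket x (bracket y z) + bracket y (bracket z x) + bracket z (bracket x y) = 0
  /-- the step `s` -/
  step : ℕ
  one_le_step : 1 ≤ step
  /-- the layers `𝔳ᵢ` -/
  layer : ℕ → Submodule ℝ E
  layer_ne_bot : ∀ i, 1 ≤ i → i ≤ step → layer i ≠ ⊥
  layer_eq_bot : ∀ i, i = 0 ∨ step < i → layer i = ⊥
  isInternal : DirectSum.IsInternal layer
  /-- `[𝔳₁, 𝔳ᵢ] = 𝔳ᵢ₊₁`; for `i = s` this says `[𝔳₁, 𝔳ₛ] = 0`. -/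
  bracket_layer : ∀ i, 1 ≤ i → Submodule.map₂ bracket (layer 1) (layer i) = layer (i + 1)

namespace CarnotGroup

section Algebra

variable {E : Type*} [AddCommGroup E] [Module ℝ E] (G : CarnotGroup E)

/-- The homogeneous dimension `Q = ∑ i * dim 𝔳ᵢ`. -/
def homDim : ℕ := ∑ i ∈ Finset.Icc 1 G.step, i * Module.finrank ℝ (G.layer i)

theorem coe_bijective : Function.Bijective (DirectSum.coeLinearMap G.layer) := G.isInternal

/-- The projection of `E = 𝔳₁ ⊕ ⋯ ⊕ 𝔳ₛ` onto the layer `𝔳ᵢ`. -/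
def proj (i : ℕ) : E →ₗ[ℝ] E :=
  (G.layer i).subtype ∘ₗ DirectSum.component ℝ ℕ (fun j => G.layer j) i ∘ₗ
    (LinearEquiv.ofBijective (DirectSum.coeLinearMap G.layer) G.coe_bijective).symm.toLinearMap

/-- The dilation `δ_t`: the linear map that multiplies `𝔳ᵢ` by `t ^ i`. -/
def dilation (t : ℝ) : E →ₗ[ℝ] E := ∑ i ∈ Finset.Icc 1 G.step, t ^ i • G.proj i

theorem dilation_of_mem {i : ℕ} {x : E} (hx : x ∈ G.layer i) (t : ℝ) :
    G.dilation t x = t ^ i • x := by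
  have key : (LinearEquiv.ofBijective (DirectSum.coeLinearMap G.layer) G.coe_bijective).symm x
      = DirectSum.lof ℝ ℕ (fun j => G.layer j) i ⟨x, hx⟩ := by
    rw [LinearEquiv.symm_apply_eq]
    simp
  have hp : ∀ j, G.proj j x = if j = i then x else 0 := by
    intro j
    simp only [proj, LinearMap.comp_apply, LinearEquiv.coe_coe, key]
    split_ifs with h
    · subst h
      simp [DirectSum.component.lof_self]
    · rw [DirectSum.component.of, dif_neg (fun h' => h h'.symm)]
      simp
  simp only [dilation, LinearMap.sum_apply, LinearMap.smul_apply, hp]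
  by_cases hi : 1 ≤ i ∧ i ≤ G.step
  · rw [Finset.sum_eq_single i]
    · simp
    · intro b _ hb
      simp [hb]
    · intro h
      exact absurd (Finset.mem_Icc.2 hi) h
  · have hb : G.layer i = ⊥ := G.layer_eq_bot i (by omega)
    have hx0 : x = 0 := by simpa [hb] using hx
    simp [hx0]

/-- `exp (ad x)`. The series stops because `(ad x) ^ s = 0`. -/
def expAd (x : E) : Module.End ℝ E :=
  ∑ k ∈ Finset.range G.step, ((k ! : ℝ))⁻¹ • (G.bracket x : Module.End ℝ E) ^ k

/-- `ψ(A)` for the function `ψ(z) = z log z / (z - 1)`, through its Taylor series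
`1 + ∑_{k ≥ 1} (-1)^(k+1) (z - 1)^k / (k (k + 1))` at `z = 1`. For the operators `A` to which it
is applied below, `(A - 1) ^ s = 0`, so that the series stops. -/
def psi (A : Module.End ℝ E) : Module.End ℝ E :=
  1 + ∑ k ∈ Finset.Ico 1 G.step, ((-1 : ℝ) ^ (k + 1) / (k * (k + 1))) • (A - 1) ^ k

end Algebra

variable {E : Type*} [NormedAddCommGroup E] [NormedSpace ℝ E] (G : CarnotGroup E)

/-- The group law, which is the Baker-Campbell-Hausdorff product
`log (exp x exp y) = x + y + [x, y] / 2 + ([x, [x, y]] + [y, [y, x]]) / 12 + ⋯`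
in its closed form `x + ∫₀¹ ψ(exp (ad x) exp (t ad y)) y dt`. -/
def mul (x y : E) : E :=
  x + ∫ t in (0 : ℝ)..1, G.psi (G.expAd x * G.expAd (t • y)) y

/-- In step two the group law is `x + y + [x, y] / 2`. -/
theorem mul_of_step_two (h : G.step = 2) [CompleteSpace E] (x y : E) :
    G.mul x y = x + y + (2 : ℝ)⁻¹ • G.bracket x y := by
  have hi : ∀ t : ℝ, G.psi (G.expAd x * G.expAd (t • y)) y = y + (2 : ℝ)⁻¹ • G.bracket x y := by
    intro t
    simp [psi, expAd, h, Finset.sum_range_succ, G.bracket_self]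
    norm_num
  simp [mul, hi, add_assoc]

/-- The function `(p, q) ↦ ‖q⁻¹ · p‖` of a homogeneous norm `N = ‖·‖`. In exponential coordinates
`q⁻¹ = -q`. -/
def qdist (N : E → ℝ) (p q : E) : ℝ := N (G.mul (-q) p)

/-- A homogeneous norm: continuous, `1`-homogeneous for the dilations `δ_t` with `t > 0`, and zero
exactly at the neutral element. -/
structure IsHomogeneousNorm (N : E → ℝ) : Prop where
  nonneg : ∀ p, 0 ≤ N p
  continuous : Continuous N
  dilation : ∀ t : ℝ, 0 < t → ∀ p, N (G.dilation t p) = t * N p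
  eq_zero_iff : ∀ p, N p = 0 ↔ p = 0

/-- The derivative of `f` at `p` along the left-invariant vector field of `x`:
`(d/dt) f (p · exp (t x))` at `t = 0`. -/
def leftDeriv (f : E → ℝ) (x p : E) : ℝ := deriv (fun t : ℝ => f (G.mul p (t • x))) 0

/-- The horizontal gradient `∑ⱼ (Xⱼ f) Xⱼ` for a basis `X` of the first layer. Its value at `p`
is given by the element of the first layer to which it corresponds under left translation. -/
def horizGrad {m : ℕ} (X : Module.Basis (Fin m) ℝ (G.layer 1)) (f : E → ℝ) (p : E) : E :=
  ∑ j, G.leftDeriv f (X j : E) p • (X j : E)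

end CarnotGroup

/-- The diameter of a set for a function `d` of two points. -/
def diamOf {α : Type*} (d : α → α → ℝ) (A : Set α) : ℝ≥0∞ :=
  ⨆ p ∈ A, ⨆ q ∈ A, ENNReal.ofReal (d p q)

/-- The `s`-dimensional Hausdorff (outer) measure for a function `d` of two points, which need
not satisfy the triangle inequality. -/
def hausdorffOf {α : Type*} (d : α → α → ℝ) (s : ℝ) (A : Set α) : ℝ≥0∞ :=
  ⨆ (r : ℝ≥0∞) (_ : 0 < r), ⨅ (t : ℕ → Set α) (_ : A ⊆ ⋃ n, t n) (_ : ∀ n, diamOf d (t n) ≤ r),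
    ∑' n, ⨆ _ : (t n).Nonempty, diamOf d (t n) ^ s

/-- For a metric this is the usual Hausdorff measure. -/
theorem hausdorffOf_dist {α : Type*} [MetricSpace α] [MeasurableSpace α] [BorelSpace α] (s : ℝ)
    (A : Set α) : hausdorffOf dist s A = Measure.hausdorffMeasure s A := by
  rw [Measure.hausdorffMeasure_apply]
  have h : ∀ B : Set α, diamOf dist B = Metric.ediam B := by
    intro B
    simp [diamOf, Metric.ediam, edist_dist]
  simp only [hausdorffOf, h]

end

/-! Fix `x` in the first layer. Along the horizontal segment `t ↦ p · t x` the derivative of `f` is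
controlled by the horizontal gradient wherever the segment avoids `S`. A set of diameter `r` is met
only by segments that start in a set of measure at most `C r ^ (Q - 1)`: about `1 / r` translates of
a ball of measure `r ^ Q` suffice. Summing over covers of `S` and using Fatou's lemma, almost every
segment meets `S` in a countable set (`ae_finite_segment`, `ae_countable_segment`). The same covers
show that `S` is null, so by continuity the gradient bound holds at every point off `S`. The
fundamental theorem of calculus with countably many exceptions then bounds `|f (p · x) - f p|` for
almost every `p`, and by continuity for every `p` (`abs_sub_le_of_leftDeriv`).

It remains to pass from horizontal segments to arbitrary pairs of points, which is Chow's theorem.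
Group commutators of horizontal elements reach every layer, Baire's theorem makes the cost uniform
near the neutral element, and dilations turn this into a cost at most `L * N g` for every `g`
(`exists_reach_homogeneousNorm`).

The group law is given only by an integral formula, so its properties have to be derived. A faithful
nilpotent representation on `E × ℝ` is exponentiated to `grp`. The curve `log (exp x * exp (t y))`
is differentiated by means of the identity `ψ (exp z) * (1 - exp (-z)) / z = 1`, and integrating its
derivative shows that `grp` is multiplicative (`grp_mul`). Associativity, inverses, conjugation and
smoothness follow from there. Invariance of Haar measure comes from dilation invariance of the
Jacobian (`det_leftDiff`). -/

noncomputable section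

/-! ### Truncated power series identities for exp, log and ψ. -/

namespace NilpotentSeries

open Polynomial

/-- The truncated exponential series. -/
def expP (n : ℕ) : ℝ[X] := ∑ k ∈ Finset.range n, C ((k ! : ℝ)⁻¹) * X ^ k

/-- The truncated series of `log (1 + X)`. -/
def logP (n : ℕ) : ℝ[X] := ∑ k ∈ Finset.range n, C ((-1 : ℝ) ^ k / (k + 1)) * X ^ (k + 1)

/-- The truncated series of `(1 + X) log (1 + X) / X`. -/
def psiP (n : ℕ) : ℝ[X] :=
  1 + ∑ k ∈ Finset.Ico 1 n, C ((-1 : ℝ) ^ (k + 1) / (k * (k + 1))) * X ^ k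

/-- The truncated series of `(1 - exp (-X)) / X`. -/
def dexpP (n : ℕ) : ℝ[X] := ∑ k ∈ Finset.range n, C (((k + 1)! : ℝ)⁻¹) * (-X) ^ k

/-- Replaces a truncated identity by its derivative and its value at `0`; the basic identities below
reduce to differential equations in this way. -/
theorem X_pow_succ_dvd_of_derivative {P : ℝ[X]} {n : ℕ} (h0 : P.eval 0 = 0)
    (h : X ^ n ∣ derivative P) : X ^ (n + 1) ∣ P := by
  rw [X_pow_dvd_iff] at h ⊢
  intro d hd
  cases d with
  | zero => rwa [coeff_zero_eq_eval_zero]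
  | succ d =>
    have := h d (by omega)
    rw [coeff_derivative] at this
    have h2 : (d : ℝ) + 1 ≠ 0 := by positivity
    exact (mul_eq_zero.1 this).resolve_right h2

theorem derivative_expP (n : ℕ) : derivative (expP (n + 1)) = expP n := by
  rw [expP, Finset.sum_range_succ', derivative_add, derivative_sum, expP]
  simp only [derivative_mul, derivative_C, zero_mul, derivative_X_pow, zero_add, pow_zero, mul_one,
    add_zero]
  refine Finset.sum_congr rfl fun k _ => ?_
  rw [← mul_assoc, ← C_mul, Nat.factorial_succ]
  congr 2
  push_cast
  have : (k : ℝ) + 1 ≠ 0 := by positivity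
  field_simp

theorem expP_succ (n : ℕ) : expP (n + 1) = expP n + C ((n ! : ℝ)⁻¹) * X ^ n := by
  simp [expP, Finset.sum_range_succ]

theorem eval_zero_expP (n : ℕ) : (expP (n + 1)).eval 0 = 1 := by
  simp [expP, eval_finsetSum, Finset.sum_range_succ']

theorem eval_zero_logP (n : ℕ) : (logP n).eval 0 = 0 := by
  simp [logP, eval_finsetSum]

theorem X_dvd_logP (n : ℕ) : X ∣ logP n := by
  rw [X_dvd_iff, coeff_zero_eq_eval_zero, eval_zero_logP]

theorem X_dvd_expP_sub_one (n : ℕ) : X ∣ expP (n + 1) - 1 := by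
  rw [X_dvd_iff, coeff_zero_eq_eval_zero, eval_sub, eval_zero_expP]; simp

theorem derivative_logP (n : ℕ) : (1 + X) * derivative (logP n) = 1 - (-X) ^ n := by
  have h : derivative (logP n) = ∑ k ∈ Finset.range n, (-X) ^ k := by
    simp only [logP, derivative_sum]
    refine Finset.sum_congr rfl fun k _ => ?_
    simp only [derivative_mul, derivative_C, zero_mul, derivative_X_pow, zero_add]
    rw [← mul_assoc, ← C_mul]
    have : (k : ℝ) + 1 ≠ 0 := by positivity
    push_cast
    rw [div_mul_cancel₀ _ this, neg_pow (X : ℝ[X])]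
    simp
  rw [h]
  have := mul_neg_geom_sum (-X : ℝ[X]) n
  rw [sub_neg_eq_add] at this
  exact this

/-- `log (exp X) = X` modulo `X ^ (n + 1)`. -/
theorem logP_comp_expP (n : ℕ) :
    X ^ (n + 1) ∣ (logP n).comp (expP (n + 1) - 1) - X := by
  set N := expP (n + 1) - 1 with hN
  have hXN : X ∣ N := X_dvd_expP_sub_one n
  refine X_pow_succ_dvd_of_derivative ?_ ?_
  · simp [eval_comp, hN, eval_zero_expP, eval_zero_logP]
  · have h1 : derivative N = 1 + N - C ((n ! : ℝ)⁻¹) * X ^ n := by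
      rw [hN, derivative_sub, derivative_expP, derivative_one, expP_succ]; ring
    have h2 : (1 + N) * (derivative (logP n)).comp N = 1 - (-N) ^ n := by
      have := congrArg (fun P => P.comp N) (derivative_logP n)
      simpa using this
    have h3 : derivative ((logP n).comp N - X)
        = - (-N) ^ n - C ((n ! : ℝ)⁻¹) * (derivative (logP n)).comp N * X ^ n := by
      rw [derivative_sub, derivative_comp, derivative_X, h1]
      linear_combination h2
    rw [h3]
    exact dvd_sub (dvd_neg.2 (pow_dvd_pow_of_dvd (dvd_neg.2 hXN) n)) (Dvd.intro_left _ rfl)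

/-- A nonzero constant term makes `V` a unit modulo `X ^ k`, so it can be cancelled. -/
theorem isCoprime_X_pow {V : ℝ[X]} (hV : V.eval 0 ≠ 0) (k : ℕ) {R : ℝ[X]} (h : X ^ k ∣ V * R) :
    X ^ k ∣ R := by
  refine (prime_X.pow_dvd_of_dvd_mul_left k ?_ h)
  rwa [X_dvd_iff, coeff_zero_eq_eval_zero]

/-- `exp (log (1 + X)) = 1 + X` modulo `X ^ (n + 1)`. -/
theorem expP_comp_logP (n : ℕ) :
    X ^ (n + 1) ∣ (expP (n + 1)).comp (logP n) - (1 + X) := by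
  set P := (expP (n + 1)).comp (logP n) with hP
  have h1 : derivative P = (P - C ((n ! : ℝ)⁻¹) * (logP n) ^ n) * derivative (logP n) := by
    rw [hP, derivative_comp, derivative_expP, expP_succ]
    simp; ring
  have h2 := derivative_logP n
  -- Both `P` and `1 + X` solve `(1 + X) u' = u` modulo `X ^ n`, hence so does their difference.
  -- Each use of the equation below gains one order of vanishing.
  have h3 : X ^ n ∣ (1 + X) * derivative (P - (1 + X)) - (P - (1 + X)) := by
    have : (1 + X) * derivative (P - (1 + X)) - (P - (1 + X))
        = -(P * (-X) ^ n) - C ((n ! : ℝ)⁻¹) * (1 - (-X) ^ n) * (logP n) ^ n := by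
      rw [derivative_sub, h1]
      simp only [derivative_add, derivative_one, derivative_X]
      linear_combination (P - C ((n ! : ℝ)⁻¹) * (logP n) ^ n) * h2
    rw [this]
    refine dvd_sub (dvd_neg.2 (Dvd.dvd.mul_left ?_ _))
      (Dvd.dvd.mul_left (pow_dvd_pow_of_dvd (X_dvd_logP n) n) _)
    exact pow_dvd_pow_of_dvd (dvd_neg.2 dvd_rfl) n
  have key : ∀ k ≤ n + 1, X ^ k ∣ P - (1 + X) := by
    intro k
    induction k with
    | zero => simp
    | succ k ih =>
      intro hk
      refine X_pow_succ_dvd_of_derivative ?_ ?_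
      · simp [hP, eval_comp, eval_zero_logP, eval_zero_expP]
      · refine isCoprime_X_pow (V := 1 + X) (by simp) k ?_
        have := dvd_add ((pow_dvd_pow X (by omega : k ≤ n)).trans h3) (ih (by omega))
        simpa using this
  exact key _ le_rfl

/-- For the full series the derivative is zero; truncation leaves only the two top terms, which are
multiples of `X ^ n`. -/
theorem expP_mul_expP_neg (n : ℕ) :
    X ^ (n + 1) ∣ expP (n + 1) * (expP (n + 1)).comp (-X) - 1 := by
  refine X_pow_succ_dvd_of_derivative ?_ ?_
  · simp [eval_comp, eval_zero_expP]
  · have h : derivative (expP (n + 1) * (expP (n + 1)).comp (-X) - 1)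
        = expP n * (expP (n + 1)).comp (-X) - expP (n + 1) * (expP n).comp (-X) := by
      simp only [derivative_sub, derivative_mul, derivative_comp, derivative_expP, derivative_one,
        derivative_neg, derivative_X]
      ring
    rw [h, expP_succ]
    simp only [add_comp, mul_comp, C_comp, pow_comp, X_comp]
    rw [neg_pow (X : ℝ[X])]
    refine ⟨- C ((n ! : ℝ)⁻¹) * (expP n).comp (-X) + C ((n ! : ℝ)⁻¹) * (-1) ^ n * expP n, ?_⟩
    ring

theorem X_mul_dexpP (n : ℕ) : X * dexpP n = 1 - (expP (n + 1)).comp (-X) := by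
  have : (expP (n + 1)).comp (-X) = 1 + ∑ k ∈ Finset.range n, C (((k + 1)! : ℝ)⁻¹) * (-X) ^ (k + 1)
      := by
    simp [expP, Finset.sum_range_succ', Polynomial.sum_comp, add_comm]
  rw [this, dexpP, Finset.mul_sum, sub_add_cancel_left, ← Finset.sum_neg_distrib]
  refine Finset.sum_congr rfl fun k _ => ?_
  ring

theorem X_mul_psiP (n : ℕ) :
    X ^ (n + 1) ∣ X * psiP (n + 1) - (1 + X) * logP n := by
  refine X_pow_succ_dvd_of_derivative ?_ ?_
  · simp [eval_zero_logP]
  · have h : derivative (X * psiP (n + 1)) = 1 + logP n := by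
      rw [psiP, logP, mul_add, derivative_add, Finset.mul_sum, derivative_sum,
        Finset.sum_Ico_eq_sum_range]
      simp only [mul_one, derivative_X, Nat.add_sub_cancel]
      congr 1
      refine Finset.sum_congr rfl fun k _ => ?_
      rw [mul_left_comm, ← pow_succ', derivative_C_mul, derivative_X_pow, ← mul_assoc, ← C_mul,
        Nat.add_sub_cancel, add_comm 1 k]
      congr 2
      have h1 : (k : ℝ) + 1 ≠ 0 := by positivity
      have h2 : (k : ℝ) + 1 + 1 ≠ 0 := by positivity
      push_cast
      field_simp
      ring
    rw [derivative_sub, h, derivative_mul, derivative_logP]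
    simp only [derivative_add, derivative_one, derivative_X]
    refine ⟨(-1) ^ n, ?_⟩
    rw [neg_pow (X : ℝ[X])]
    ring

/-- `ψ (exp X) * (1 - exp (-X)) / X = 1` modulo `X ^ n`. -/
theorem psiP_comp_mul_dexpP (n : ℕ) :
    X ^ n ∣ (psiP (n + 2)).comp (expP (n + 2) - 1) * dexpP (n + 1) - 1 := by
  set N := expP (n + 2) - 1 with hN
  set W := (dexpP (n + 1)).comp (-X) with hW
  have hNW : N = X * W := by
    have := congrArg (fun P => P.comp (-X)) (X_mul_dexpP (n + 1))
    simp only [mul_comp, X_comp, sub_comp, one_comp, comp_assoc, neg_comp, neg_neg, comp_X] at this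
    rw [hN, hW]
    linear_combination this
  have hXN : X ∣ N := ⟨W, hNW⟩
  have h1 : X ^ (n + 2) ∣ N * (psiP (n + 2)).comp N - (1 + N) * (logP (n + 1)).comp N := by
    obtain ⟨q, hq⟩ := X_mul_psiP (n + 1)
    have := congrArg (fun P => P.comp N) hq
    simp only [mul_comp, X_comp, sub_comp, one_comp, add_comp, pow_comp] at this
    rw [this]
    exact Dvd.dvd.mul_right (pow_dvd_pow_of_dvd hXN _) _
  have h2 : X ^ (n + 2) ∣ (logP (n + 1)).comp N - X := logP_comp_expP (n + 1)
  have h3 : X ^ (n + 2) ∣ expP (n + 2) * (expP (n + 2)).comp (-X) - 1 := expP_mul_expP_neg (n + 1)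
  have h4 := X_mul_dexpP (n + 1)
  set e' := (expP (n + 1 + 1)).comp (-X)
  set R := (psiP (n + 2)).comp N * dexpP (n + 1) - 1 with hR
  -- Since `N = X * W`, the factor `X ^ 2 * W` clears the denominators of ψ and of `(1 - exp (-X)) /
  -- X`. Cancelling `X ^ 2` costs two orders; `W` has constant term `1` and costs none.
  have h5 : X ^ (n + 2) ∣ X ^ 2 * (W * R) := by
    have he : expP (n + 2) = 1 + N := by rw [hN]; ring
    rw [he] at h3
    have : X ^ 2 * (W * R) = (N * (psiP (n + 2)).comp N - (1 + N) * (logP (n + 1)).comp N)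
          * (1 - e') + ((logP (n + 1)).comp N - X) * ((1 + N) * (1 - e'))
          - ((1 + N) * e' - 1) * X := by
      rw [hR]
      linear_combination (X * (1 - (psiP (n + 2)).comp N * dexpP (n + 1))) * hNW
        + N * (psiP (n + 2)).comp N * h4
    rw [this]
    exact dvd_sub (dvd_add (h1.mul_right _) (h2.mul_right _)) (h3.mul_right _)
  rw [add_comm n 2, pow_add, mul_dvd_mul_iff_left (pow_ne_zero 2 X_ne_zero)] at h5
  refine isCoprime_X_pow (V := W) ?_ n h5
  simp [hW, dexpP, eval_finsetSum, Finset.sum_range_succ']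

end NilpotentSeries

/-! ### Exponential and logarithm in an algebra with a nilpotent filtration. -/

namespace NilpotentSeries

open Polynomial

theorem aeval_eq_of_dvd {A : Type*} [Ring A] [Algebra ℝ A] {P Q : ℝ[X]} {n : ℕ}
    (h : X ^ n ∣ P - Q) {a : A} (ha : a ^ n = 0) : aeval a P = aeval a Q := by
  obtain ⟨R, hR⟩ := h
  rw [← sub_eq_zero, ← map_sub, hR]
  simp [ha]

/-- It is enough that `u ^ n` kills the one vector `v`. This serves for commutator operators, which
are applied to elements of `R 1`. -/
theorem aeval_apply_eq_of_dvd {V : Type*} [AddCommGroup V] [Module ℝ V] {P Q : ℝ[X]} {n : ℕ}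
    (h : X ^ n ∣ P - Q) {u : Module.End ℝ V} {v : V} (hv : (u ^ n) v = 0) :
    aeval u P v = aeval u Q v := by
  obtain ⟨R, hR⟩ := h
  rw [← sub_eq_zero, ← LinearMap.sub_apply, ← map_sub, hR, mul_comm]
  simp [hv]

theorem X_pow_dvd_expP_sub {m n : ℕ} (h : m ≤ n) : X ^ m ∣ expP n - expP m := by
  rw [expP, expP, ← Finset.sum_range_add_sum_Ico _ h, add_sub_cancel_left]
  exact Finset.dvd_sum fun k hk => Dvd.dvd.mul_left (pow_dvd_pow _ (Finset.mem_Ico.1 hk).1) _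

theorem X_pow_dvd_psiP_sub {m n : ℕ} (hm : 1 ≤ m) (h : m ≤ n) : X ^ m ∣ psiP n - psiP m := by
  rw [psiP, psiP, ← Finset.sum_Ico_consecutive _ hm h, add_sub_add_left_eq_sub,
    add_sub_cancel_left]
  exact Finset.dvd_sum fun k hk => Dvd.dvd.mul_left (pow_dvd_pow _ (Finset.mem_Ico.1 hk).1) _

theorem aeval_expP {A : Type*} [Ring A] [Algebra ℝ A] (a : A) (n : ℕ) :
    aeval a (expP n) = ∑ k ∈ Finset.range n, ((k ! : ℝ)⁻¹) • a ^ k := by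
  simp [expP, Algebra.smul_def]

/-- The exponential of a nilpotent element does not depend on where its series is truncated. -/
theorem aeval_expP_eq {A : Type*} [Ring A] [Algebra ℝ A] {a : A} {m n : ℕ} (hm : a ^ m = 0)
    (hn : a ^ n = 0) : aeval a (expP m) = aeval a (expP n) := by
  rcases le_total m n with h | h
  · exact (aeval_eq_of_dvd (X_pow_dvd_expP_sub h) hm).symm
  · exact aeval_eq_of_dvd (X_pow_dvd_expP_sub h) hn

theorem aeval_expP_eq_exp {A : Type*} [Ring A] [Algebra ℝ A] [Module ℚ A] {a : A} {n : ℕ}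
    (ha : a ^ n = 0) : aeval a (expP n) = IsNilpotent.exp a := by
  rw [aeval_expP, IsNilpotent.exp_eq_sum ha]
  refine Finset.sum_congr rfl fun k _ => ?_
  rw [← inv_natCast_smul_eq ℝ ℚ]

theorem expP_add {A : Type*} [Ring A] [Algebra ℝ A] {a b : A} {n : ℕ} (hab : Commute a b)
    (ha : a ^ n = 0) (hb : b ^ n = 0) (h : (a + b) ^ n = 0) :
    aeval (a + b) (expP n) = aeval a (expP n) * aeval b (expP n) := by
  let : Module ℚ A := Module.compHom A (algebraMap ℚ ℝ)
  rw [aeval_expP_eq_exp ha, aeval_expP_eq_exp hb, aeval_expP_eq_exp h,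
    IsNilpotent.exp_add_of_commute hab ⟨n, ha⟩ ⟨n, hb⟩]

theorem expP_mul_neg {A : Type*} [Ring A] [Algebra ℝ A] {a : A} {n : ℕ} (ha : a ^ (n + 1) = 0) :
    aeval a (expP (n + 1)) * aeval (-a) (expP (n + 1)) = 1 := by
  have := aeval_eq_of_dvd (expP_mul_expP_neg n) ha
  simpa [aeval_comp] using this

theorem expP_logP {A : Type*} [Ring A] [Algebra ℝ A] {b : A} {n : ℕ} (hb : b ^ (n + 1) = 0) :
    aeval (aeval b (logP n)) (expP (n + 1)) = 1 + b := by
  have := aeval_eq_of_dvd (expP_comp_logP n) hb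
  simpa [aeval_comp] using this

theorem logP_expP {A : Type*} [Ring A] [Algebra ℝ A] {a : A} {n : ℕ} (ha : a ^ (n + 1) = 0) :
    aeval (aeval a (expP (n + 1)) - 1) (logP n) = a := by
  have := aeval_eq_of_dvd (logP_comp_expP n) ha
  simpa [aeval_comp] using this

/-- Both sides are formally `(l ^ (n + 1) - (l - u) ^ (n + 1)) / u`. Division by `u` is avoided by
induction with Pascal's rule. With `l` left multiplication and `u` the commutator, `l - u` is right
multiplication. -/
theorem sum_pow_mul_sub_pow {A : Type*} [Ring A] {l u : A} (h : Commute l u) (n : ℕ) :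
    ∑ k ∈ Finset.range (n + 1), l ^ (n - k) * (l - u) ^ k
      = ∑ k ∈ Finset.range (n + 1), ((n + 1).choose (k + 1)) • (l ^ (n - k) * (-u) ^ k) := by
  induction n with
  | zero => simp
  | succ n ih =>
    have h1 : ∑ k ∈ Finset.range (n + 2), l ^ (n + 1 - k) * (l - u) ^ k
        = (∑ k ∈ Finset.range (n + 1), l ^ (n - k) * (l - u) ^ k) * (l - u) + l ^ (n + 1) := by
      rw [Finset.sum_range_succ', Finset.sum_mul]
      congr 1
      · refine Finset.sum_congr rfl fun k _ => ?_
        rw [pow_succ, mul_assoc, Nat.add_sub_add_right]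
      · simp
    have hlu : ∀ k, Commute l ((-u) ^ k) := fun k => (h.neg_right).pow_right k
    have h2 : (∑ k ∈ Finset.range (n + 1), ((n + 1).choose (k + 1)) • (l ^ (n - k) * (-u) ^ k)) * l
        = ∑ k ∈ Finset.range (n + 2), ((n + 1).choose (k + 1)) • (l ^ (n + 1 - k) * (-u) ^ k) := by
      rw [Finset.sum_range_succ _ (n + 1), Finset.sum_mul]
      simp only [Nat.choose_succ_self, zero_smul, add_zero]
      refine Finset.sum_congr rfl fun k hk => ?_
      rw [smul_mul_assoc, mul_assoc, ← (hlu k).eq, ← mul_assoc, ← pow_succ]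
      rw [show n + 1 - k = n - k + 1 by have := Finset.mem_range.1 hk; omega]
    have h3 : (∑ k ∈ Finset.range (n + 1), ((n + 1).choose (k + 1)) • (l ^ (n - k) * (-u) ^ k))
        * (-u) + l ^ (n + 1)
        = ∑ k ∈ Finset.range (n + 2), ((n + 1).choose k) • (l ^ (n + 1 - k) * (-u) ^ k) := by
      rw [Finset.sum_range_succ' _ (n + 1), Finset.sum_mul]
      congr 1
      · refine Finset.sum_congr rfl fun k hk => ?_
        rw [smul_mul_assoc, mul_assoc, ← pow_succ, Nat.add_sub_add_right]
      · simp
    rw [h1, ih, sub_eq_add_neg, mul_add, h2, add_assoc, h3, ← Finset.sum_add_distrib]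
    refine Finset.sum_congr rfl fun k _ => ?_
    rw [← add_smul, Nat.choose_succ_succ (n + 1) k, add_comm]

/-- The terms off the triangle vanish, so a Cauchy product of truncated series may be summed over a
square. -/
theorem sum_range_triangle {M : Type*} [AddCommMonoid M] {m p : ℕ} (hp : m ≤ p) (f : ℕ → ℕ → M)
    (hf : ∀ a k, m ≤ a + k → f a k = 0) :
    ∑ n ∈ Finset.range m, ∑ k ∈ Finset.range (n + 1), f (n - k) k
      = ∑ a ∈ Finset.range p, ∑ k ∈ Finset.range p, f a k := by
  rw [Finset.sum_sigma', ← Finset.sum_product']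
  refine Finset.sum_bij_ne_zero (fun x _ _ => (x.1 - x.2, x.2)) ?_ ?_ ?_ ?_
  · rintro ⟨n, k⟩ h _
    simp only [Finset.mem_sigma, Finset.mem_range, Finset.mem_product] at h ⊢
    omega
  · rintro ⟨n, k⟩ h _ ⟨n', k'⟩ h' _ he
    simp only [Finset.mem_sigma, Finset.mem_range, Prod.mk.injEq] at h h' he
    obtain rfl : k = k' := he.2
    obtain rfl : n = n' := by omega
    rfl
  · rintro ⟨a, k⟩ h hne
    have : a + k < m := by
      by_contra! hc
      exact hne (hf a k hc)
    refine ⟨⟨a + k, k⟩, ?_, ?_, ?_⟩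
    · simp only [Finset.mem_sigma, Finset.mem_range]; omega
    · simpa using hne
    · simp
  · rintro ⟨n, k⟩ h _
    rfl

/-- The commutator `V ↦ M V - V M` with a fixed element. -/
def adR {A : Type*} [Ring A] [Algebra ℝ A] (a : A) : Module.End ℝ A :=
  LinearMap.mulLeft ℝ a - LinearMap.mulRight ℝ a

theorem adR_apply {A : Type*} [Ring A] [Algebra ℝ A] (a b : A) : adR a b = a * b - b * a := rfl

theorem commute_mulLeft_mulRight {A : Type*} [Ring A] [Algebra ℝ A] (a b : A) :
    Commute (LinearMap.mulLeft ℝ a) (LinearMap.mulRight ℝ b) :=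
  by
  ext c; simp [mul_assoc]

theorem aeval_mulLeft {A : Type*} [Ring A] [Algebra ℝ A] (a : A) (P : ℝ[X]) :
    aeval (LinearMap.mulLeft ℝ a) P = LinearMap.mulLeft ℝ (aeval a P) := by
  ext b
  simp [aeval_eq_sum_range, LinearMap.pow_mulLeft, Finset.sum_mul]

theorem aeval_mulRight {A : Type*} [Ring A] [Algebra ℝ A] (a : A) (P : ℝ[X]) :
    aeval (LinearMap.mulRight ℝ a) P = LinearMap.mulRight ℝ (aeval a P) := by
  ext b
  simp [aeval_eq_sum_range, LinearMap.pow_mulRight, Finset.mul_sum]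

/-- A decreasing multiplicative filtration of an algebra that ends with `R m = 0`. -/
structure IsNilFiltration {A : Type*} [Ring A] [Algebra ℝ A] (R : ℕ → Submodule ℝ A) (m : ℕ) :
    Prop where
  mul_mem : ∀ {i j a b}, a ∈ R i → b ∈ R j → a * b ∈ R (i + j)
  one_mem : 1 ∈ R 0
  anti : Antitone R
  bot : R m = ⊥

namespace IsNilFiltration

variable {A : Type*} [Ring A] [Algebra ℝ A] {R : ℕ → Submodule ℝ A} {m : ℕ}
  (hR : IsNilFiltration R m)

include hR

theorem eq_zero {k : ℕ} (hk : m ≤ k) {a : A} (ha : a ∈ R k) : a = 0 := by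
  have := hR.anti hk ha
  simpa [hR.bot] using this

theorem pow_mem {i : ℕ} {a : A} (ha : a ∈ R i) (k : ℕ) : a ^ k ∈ R (i * k) := by
  induction k with
  | zero => simpa using hR.one_mem
  | succ k ih => rw [pow_succ, Nat.mul_succ]; exact hR.mul_mem ih ha

theorem pow_eq_zero {a : A} (ha : a ∈ R 1) {k : ℕ} (hk : m ≤ k) : a ^ k = 0 :=
  hR.eq_zero hk (by simpa using hR.pow_mem ha k)

theorem aeval_mem {a : A} (ha : a ∈ R 1) {P : ℝ[X]} (hP : X ∣ P) : aeval a P ∈ R 1 := by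
  obtain ⟨Q, rfl⟩ := hP
  rw [map_mul, aeval_X]
  refine hR.mul_mem (j := 0) ha ?_
  rw [aeval_eq_sum_range]
  refine Submodule.sum_mem _ fun k _ => Submodule.smul_mem _ _ ?_
  exact hR.anti (Nat.zero_le _) (hR.pow_mem ha k)

theorem adR_pow_mem {a b : A} (ha : a ∈ R 1) (hb : b ∈ R 1) (k : ℕ) : (adR a ^ k) b ∈ R (k + 1) := by
  induction k with
  | zero => simpa using hb
  | succ k ih =>
    rw [pow_succ', Module.End.mul_apply, adR_apply]
    refine Submodule.sub_mem _ ?_ (hR.mul_mem ih ha)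
    rw [add_comm]
    exact hR.mul_mem ha ih

theorem adR_pow_eq_zero {a b : A} (ha : a ∈ R 1) (hb : b ∈ R 1) {k : ℕ} (hk : m ≤ k + 1) :
    (adR a ^ k) b = 0 := hR.eq_zero hk (hR.adR_pow_mem ha hb k)

/-- The derivative of the exponential series at `M`, in the direction `V`. -/
theorem sum_derivative_expP {M V : A} (hM : M ∈ R 1) (hV : V ∈ R 1) :
    ∑ k ∈ Finset.range (m + 1), ((k ! : ℝ)⁻¹) • ∑ i ∈ Finset.range k, M ^ (k.pred - i) * V * M ^ i
      = aeval M (expP (m + 1)) * aeval (adR M) (dexpP (m + 1)) V := by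
  set l := LinearMap.mulLeft ℝ M
  set u := adR M with hu
  have hlu : Commute l u := (Commute.refl l).sub_right (commute_mulLeft_mulRight M M)
  have hl : ∀ (k : ℕ) (W : A), (l ^ k) W = M ^ k * W := fun k W => by
    rw [LinearMap.pow_mulLeft]; rfl
  have hr : l - u = LinearMap.mulRight ℝ M := by simp [l, hu, adR]
  have h1 : ∀ n, ∑ i ∈ Finset.range (n + 1), M ^ (n - i) * V * M ^ i
      = ∑ k ∈ Finset.range (n + 1), ((n + 1).choose (k + 1) : ℝ) • (l ^ (n - k)) (((-u) ^ k) V) := by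
    intro n
    have := congrArg (fun T : Module.End ℝ A => T V) (sum_pow_mul_sub_pow hlu n)
    simp only [LinearMap.sum_apply, Module.End.mul_apply, LinearMap.smul_apply, hr] at this
    simp only [Nat.cast_smul_eq_nsmul]
    rw [← this]
    refine Finset.sum_congr rfl fun i _ => ?_
    rw [hl, LinearMap.pow_mulRight, LinearMap.mulRight_apply, mul_assoc]
  have h2 : aeval M (expP (m + 1)) * aeval u (dexpP (m + 1)) V
      = ∑ a ∈ Finset.range (m + 1), ∑ k ∈ Finset.range (m + 1),
        ((a ! : ℝ)⁻¹ * ((k + 1)! : ℝ)⁻¹) • (l ^ a) (((-u) ^ k) V) := by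
    rw [aeval_expP, Finset.sum_mul]
    refine Finset.sum_congr rfl fun a _ => ?_
    simp only [dexpP, map_sum, map_mul, aeval_C, map_pow, map_neg, aeval_X, LinearMap.sum_apply,
      Finset.mul_sum, hl]
    refine Finset.sum_congr rfl fun k _ => ?_
    rw [← Algebra.smul_def, LinearMap.smul_apply, smul_mul_smul_comm]
  rw [h2, ← sum_range_triangle (Nat.le_succ m), Finset.sum_range_succ']
  · simp only [Finset.range_zero, Finset.sum_empty, smul_zero, add_zero, Nat.pred_succ, h1,
      Finset.smul_sum, smul_smul]
    refine Finset.sum_congr rfl fun n _ => Finset.sum_congr rfl fun k hk => ?_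
    congr 1
    have hk' : k + 1 ≤ n + 1 := Finset.mem_range.1 hk
    rw [Nat.cast_choose ℝ hk', Nat.add_sub_add_right]
    have h3 : ((n + 1)! : ℝ) ≠ 0 := by positivity
    field_simp
  · intro a k hak
    rw [hl, neg_pow u, Module.End.mul_apply]
    have h3 : ((-1 : Module.End ℝ A) ^ k) ((u ^ k) V) ∈ R (k + 1) := by
      have := hR.adR_pow_mem hM hV k
      rcases neg_one_pow_eq_or (Module.End ℝ A) k with h | h <;> rw [h] <;> simpa using this
    have h4 := hR.mul_mem (hR.pow_mem hM a) h3
    rw [hR.eq_zero (by omega) h4, smul_zero]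

/-- `exp (ad M) V = exp M * V * exp (- M)`. -/
theorem expP_adR {M V : A} (hM : M ∈ R 1) (hV : V ∈ R 1) {q : ℕ} (hq : m ≤ q) :
    aeval (adR M) (expP q) V = aeval M (expP q) * V * aeval (-M) (expP q) := by
  let : Module ℚ (Module.End ℝ A) := Module.compHom _ (algebraMap ℚ ℝ)
  have hl : (LinearMap.mulLeft ℝ M) ^ q = 0 := by
    rw [LinearMap.pow_mulLeft, hR.pow_eq_zero hM hq, LinearMap.mulLeft_zero_eq_zero]
  have hr : (LinearMap.mulRight ℝ (-M)) ^ q = 0 := by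
    rw [LinearMap.pow_mulRight, hR.pow_eq_zero (neg_mem hM) hq, LinearMap.mulRight_zero_eq_zero]
  have hc : Commute (LinearMap.mulLeft ℝ M) (LinearMap.mulRight ℝ (-M)) :=
    commute_mulLeft_mulRight M (-M)
  have hlr : adR M = LinearMap.mulLeft ℝ M + LinearMap.mulRight ℝ (-M) := by
    ext b; simp [adR, sub_eq_add_neg]
  -- As a sum of two commuting operators, `adR M` needs the longer truncation `q + q`; the
  -- additional terms vanish on `V`.
  have hu : adR M ^ (q + q) = 0 := by
    rw [hlr]
    exact hc.add_pow_eq_zero_of_add_le_succ_of_pow_eq_zero hl hr (by omega)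
  have h1 : aeval (adR M) (expP q) V = aeval (adR M) (expP (q + q)) V :=
    (aeval_apply_eq_of_dvd (X_pow_dvd_expP_sub (by omega))
      (hR.adR_pow_eq_zero hM hV (by omega))).symm
  rw [h1, aeval_expP_eq_exp hu, hlr, IsNilpotent.exp_add_of_commute hc ⟨q, hl⟩ ⟨q, hr⟩,
    ← aeval_expP_eq_exp hl, ← aeval_expP_eq_exp hr, aeval_mulLeft, aeval_mulRight]
  simp [mul_assoc]

theorem aeval_sub_one_mem {a : A} (ha : a ∈ R 1) (n : ℕ) : aeval a (expP (n + 1)) - 1 ∈ R 1 := by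
  simpa using hR.aeval_mem ha (X_dvd_expP_sub_one n)

end IsNilFiltration

namespace IsNilFiltration

variable {A : Type*} [NormedRing A] [NormedAlgebra ℝ A] {R : ℕ → Submodule ℝ A} {m : ℕ}
  (hR : IsNilFiltration R m)

include hR

/-- Differentiating `exp L` gives `y = ((1 - exp (-ad L)) / ad L) L'`, and ψ evaluated at `exp (ad
L)` inverts this operator. -/
theorem eq_psiP_of_hasDerivAt {L : ℝ → A} {L' y : A} {t : ℝ} (hL : HasDerivAt L L' t)
    (hmem : ∀ s, L s ∈ R 1) (hL' : L' ∈ R 1)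
    (h : HasDerivAt (fun s => aeval (L s) (expP (m + 2))) (aeval (L t) (expP (m + 2)) * y) t) :
    L' = aeval (aeval (adR (L t)) (expP (m + 2)) - 1) (psiP (m + 2)) y := by
  have he : ∀ s, aeval (L s) (expP (m + 2)) = aeval (L s) (expP (m + 1)) := fun s =>
    aeval_expP_eq (hR.pow_eq_zero (hmem s) (by omega)) (hR.pow_eq_zero (hmem s) (by omega))
  simp only [he] at h
  have h1 : HasDerivAt (fun s => aeval (L s) (expP (m + 1)))
      (aeval (L t) (expP (m + 1)) * aeval (adR (L t)) (dexpP (m + 1)) L') t := by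
    rw [← hR.sum_derivative_expP (hmem t) hL']
    simp only [aeval_expP]
    exact HasDerivAt.fun_sum fun k _ => (hL.fun_pow' k).fun_const_smul _
  have h2 := h1.unique h
  have h3 : aeval (-L t) (expP (m + 1)) * aeval (L t) (expP (m + 1)) = 1 := by
    have := expP_mul_neg (hR.pow_eq_zero (neg_mem (hmem t)) (Nat.le_succ m))
    rwa [neg_neg] at this
  have h4 : aeval (adR (L t)) (dexpP (m + 1)) L' = y := by
    have := congrArg (fun z => aeval (-L t) (expP (m + 1)) * z) h2
    simpa only [← mul_assoc, h3, one_mul] using this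
  have h5 := aeval_apply_eq_of_dvd (psiP_comp_mul_dexpP m)
    (hR.adR_pow_eq_zero (hmem t) hL' (Nat.le_succ m))
  rw [map_mul, Module.End.mul_apply, h4, aeval_comp] at h5
  simpa using h5.symm

theorem hasDerivAt_exp_smul {y : A} (hy : y ∈ R 1) {q : ℕ} (hq : m ≤ q) (t : ℝ) :
    HasDerivAt (fun s : ℝ => aeval (s • y) (expP (q + 1))) (aeval (t • y) (expP (q + 1)) * y) t := by
  have h : aeval (t • y) (expP (q + 1)) = aeval (t • y) (expP q) :=
    aeval_expP_eq (hR.pow_eq_zero (Submodule.smul_mem _ _ hy) (by omega))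
      (hR.pow_eq_zero (Submodule.smul_mem _ _ hy) (by omega))
  rw [h]
  simp only [aeval_expP, Finset.sum_range_succ', _root_.smul_pow, Finset.sum_mul]
  simp only [pow_zero, Nat.factorial_zero, Nat.cast_one, inv_one, one_smul]
  refine HasDerivAt.add_const _ (HasDerivAt.fun_sum fun k _ => ?_)
  have h1 := (((hasDerivAt_id' t).fun_pow (k + 1)).smul_const (y ^ (k + 1))).fun_const_smul
    (((k + 1)! : ℝ)⁻¹)
  convert h1 using 1
  rw [smul_mul_assoc, smul_mul_assoc, ← pow_succ, smul_smul, smul_smul]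
  congr 1
  simp only [Nat.factorial_succ, Nat.cast_mul, Nat.add_sub_cancel]
  have : ((k + 1 : ℕ) : ℝ) ≠ 0 := by positivity
  field_simp

/-- The logarithm of `exp x * exp (t y)` as a curve: its initial value, its derivative, its
exponential and the adjoint action of its exponential. -/
theorem exists_log_curve {x y : A} (hx : x ∈ R 1) (hy : y ∈ R 1) (t : ℝ) :
    let e : A → A := fun a => aeval a (expP (m + 2))
    let L : ℝ → A := fun s => aeval (e x * e (s • y) - 1) (logP (m + 1))
    L 0 = x ∧ L t ∈ R 1 ∧ e (L t) = e x * e (t • y) ∧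
    (∀ V ∈ R 1, aeval (adR (L t)) (expP (m + 2)) V
      = aeval (adR x) (expP (m + 2)) (aeval (adR (t • y)) (expP (m + 2)) V)) ∧
    HasDerivAt L (aeval (aeval (adR (L t)) (expP (m + 2)) - 1) (psiP (m + 2)) y) t := by
  intro e L
  have hty : ∀ s : ℝ, s • y ∈ R 1 := fun s => Submodule.smul_mem _ _ hy
  have hA : ∀ s : ℝ, e x * e (s • y) - 1 ∈ R 1 := by
    intro s
    have h1 := hR.aeval_sub_one_mem hx (m + 1)
    have h2 := hR.aeval_sub_one_mem (hty s) (m + 1)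
    have h3 := hR.anti (show 1 ≤ 1 + 1 by omega) (hR.mul_mem h1 h2)
    have : e x * e (s • y) - 1 = (e x - 1) * (e (s • y) - 1) + ((e x - 1) + (e (s • y) - 1)) := by
      noncomm_ring
    rw [this]
    exact add_mem h3 (add_mem h1 h2)
  have hLmem : ∀ s, L s ∈ R 1 := fun s => hR.aeval_mem (hA s) (X_dvd_logP _)
  have heL : ∀ s, e (L s) = e x * e (s • y) := by
    intro s
    have := expP_logP (n := m + 1) (hR.pow_eq_zero (hA s) (by omega))
    rw [add_sub_cancel] at this
    exact this
  have heneg : ∀ a ∈ R 1, e a * e (-a) = 1 := fun a ha =>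
    expP_mul_neg (hR.pow_eq_zero ha (by omega))
  have heneg' : ∀ a ∈ R 1, e (-a) * e a = 1 := fun a ha => by
    simpa using heneg (-a) (neg_mem ha)
  refine ⟨?_, hLmem t, heL t, ?_, ?_⟩
  · have : e (0 : A) = 1 := by
      simp [e, aeval_expP, Finset.sum_range_succ']
    simp only [L, zero_smul, this, mul_one]
    exact logP_expP (hR.pow_eq_zero hx (by omega))
  · intro V hV
    have h1 : aeval (adR (t • y)) (expP (m + 2)) V = e (t • y) * V * e (-(t • y)) :=
      hR.expP_adR (hty t) hV (by omega)
    have h2 : e (t • y) * V * e (-(t • y)) ∈ R 1 := by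
      have h0 : ∀ a ∈ R 1, e a ∈ R 0 := fun a ha => by
        have := add_mem (hR.anti (Nat.zero_le 1) (hR.aeval_sub_one_mem ha (m + 1))) hR.one_mem
        simpa using this
      have := hR.mul_mem (hR.mul_mem (h0 _ (hty t)) hV) (h0 _ (neg_mem (hty t)))
      simpa using this
    rw [h1, hR.expP_adR (hLmem t) hV (by omega), hR.expP_adR hx h2 (by omega)]
    have h3 : e (-L t) = e (-(t • y)) * e (-x) := by
      have h4 : (e (-(t • y)) * e (-x)) * e (L t) = 1 := by
        rw [heL, mul_assoc, ← mul_assoc (e (-x)), heneg' x hx, one_mul, heneg' _ (hty t)]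
      calc e (-L t) = (e (-(t • y)) * e (-x)) * e (L t) * e (-L t) := by rw [h4, one_mul]
        _ = _ := by rw [mul_assoc, heneg _ (hLmem t), mul_one]
    change e (L t) * V * e (-L t) = e x * (e (t • y) * V * e (-(t • y))) * e (-x)
    rw [h3, heL]
    noncomm_ring
  · have hdA : HasDerivAt (fun s : ℝ => e x * e (s • y)) (e x * e (t • y) * y) t := by
      rw [mul_assoc]
      exact (hR.hasDerivAt_exp_smul hy (Nat.le_succ m) t).const_mul (e x)
    have hdA1 := hdA.sub_const 1
    -- Only the existence of the derivative and its place in the filtration are taken from the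
    -- logarithm series; its closed form comes from differentiating `e (L s)`.
    obtain ⟨L', hL', hLd⟩ : ∃ L' ∈ R 1, HasDerivAt L L' t := by
      have hL : L = fun s => ∑ k ∈ Finset.range (m + 1),
          ((-1 : ℝ) ^ k / (k + 1)) • (e x * e (s • y) - 1) ^ (k + 1) := by
        funext s
        simp [L, logP, Algebra.smul_def]
      rw [hL]
      refine ⟨_, ?_, HasDerivAt.fun_sum fun k _ => (hdA1.fun_pow' (k + 1)).fun_const_smul _⟩
      have h0 : ∀ k, (e x * e (t • y) - 1) ^ k ∈ R 0 := fun k =>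
        hR.anti (Nat.zero_le _) (hR.pow_mem (hA t) k)
      have h1 : e x * e (t • y) * y ∈ R 1 := by
        have := hR.mul_mem (add_mem (hR.anti (Nat.zero_le 1) (hA t)) hR.one_mem) hy
        simpa using this
      refine Submodule.sum_mem _ fun k _ => Submodule.smul_mem _ _ (Submodule.sum_mem _ fun i _ => ?_)
      have := hR.mul_mem (hR.mul_mem (h0 ((k + 1).pred - i)) h1) (h0 i)
      simpa using this
    have h := hR.eq_psiP_of_hasDerivAt hLd hLmem hL' (by
      change HasDerivAt (fun s => e (L s)) (e (L t) * y) t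
      simpa only [heL] using hdA)
    rwa [← h]

end IsNilFiltration

end NilpotentSeries

/-! ### The graded Lie algebra: multipliers, dilations and the lower central filtration. -/

namespace CarnotGroup

section Algebra

variable {E : Type*} [AddCommGroup E] [Module ℝ E] (G : CarnotGroup E)

theorem proj_of_mem {i : ℕ} {x : E} (hx : x ∈ G.layer i) (j : ℕ) :
    G.proj j x = if j = i then x else 0 := by
  have key : (LinearEquiv.ofBijective (DirectSum.coeLinearMap G.layer) G.coe_bijective).symm x
      = DirectSum.lof ℝ ℕ (fun j => G.layer j) i ⟨x, hx⟩ := by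
    rw [LinearEquiv.symm_apply_eq]
    simp
  simp only [proj, LinearMap.comp_apply, LinearEquiv.coe_coe, key]
  split_ifs with h
  · subst h
    simp [DirectSum.component.lof_self]
  · rw [DirectSum.component.of, dif_neg (fun h' => h h'.symm)]
    simp

theorem iSup_layer : ⨆ i, G.layer i = ⊤ := G.isInternal.submodule_iSup_eq_top

variable {G} in
theorem ext_layer {F : Type*} [AddCommGroup F] [Module ℝ F] {f g : E →ₗ[ℝ] F}
    (h : ∀ i, ∀ x ∈ G.layer i, f x = g x) : f = g := by
  rw [← sub_eq_zero, ← LinearMap.ker_eq_top, eq_top_iff, ← G.iSup_layer, iSup_le_iff]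
  intro i x hx
  simp [h i x hx]

/-- The multiplier `∑ c i * proj i`, which acts on the `i`-th layer as `c i`. -/
def layerMul (c : ℕ → ℝ) : E →ₗ[ℝ] E := ∑ i ∈ Finset.Icc 1 G.step, c i • G.proj i

theorem layerMul_of_mem (c : ℕ → ℝ) {i : ℕ} {x : E} (hx : x ∈ G.layer i) :
    G.layerMul c x = c i • x := by
  simp only [layerMul, LinearMap.sum_apply, LinearMap.smul_apply, G.proj_of_mem hx]
  by_cases hi : 1 ≤ i ∧ i ≤ G.step
  · rw [Finset.sum_eq_single i]
    · simp
    · intro b _ hb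
      simp [hb]
    · intro h
      exact absurd (Finset.mem_Icc.2 hi) h
  · have hb : G.layer i = ⊥ := G.layer_eq_bot i (by omega)
    have hx0 : x = 0 := by simpa [hb] using hx
    simp [hx0]

theorem layer_zero : G.layer 0 = ⊥ := G.layer_eq_bot 0 (Or.inl rfl)

theorem bracket_skew (x y : E) : G.bracket x y = - G.bracket y x := by
  have h := G.bracket_self (x + y)
  simp only [map_add, LinearMap.add_apply, G.bracket_self, zero_add, add_zero] at h
  exact eq_neg_of_add_eq_zero_right h

theorem bracket_bracket (x y z : E) :
    G.bracket (G.bracket x y) z = G.bracket x (G.bracket y z) - G.bracket y (G.bracket x z) := by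
  have h := G.jacobi x y z
  rw [G.bracket_skew z (G.bracket x y), G.bracket_skew z x, map_neg] at h
  rw [← sub_eq_zero, ← neg_eq_zero]
  rw [← h]; abel

theorem bracket_one_mem_layer {x y : E} (hx : x ∈ G.layer 1) {j : ℕ} (hy : y ∈ G.layer j) :
    G.bracket x y ∈ G.layer (j + 1) := by
  rcases Nat.eq_zero_or_pos j with rfl | hj
  · rw [G.layer_zero, Submodule.mem_bot] at hy
    simp [hy]
  · rw [← G.bracket_layer j hj]
    exact Submodule.apply_mem_map₂ _ hx hy

/-- The stratification only controls brackets with the first layer. As these span the next layer,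
the Jacobi identity carries the grading up by induction on `i`. -/
theorem bracket_mem_layer {i j : ℕ} {x y : E} (hx : x ∈ G.layer i) (hy : y ∈ G.layer j) :
    G.bracket x y ∈ G.layer (i + j) := by
  induction i generalizing x y j with
  | zero =>
    rw [G.layer_zero, Submodule.mem_bot] at hx
    simp [hx]
  | succ i ih =>
    rcases Nat.eq_zero_or_pos i with rfl | hi
    · rw [zero_add, add_comm]
      exact G.bracket_one_mem_layer hx hy
    · have hle : G.layer (i + 1) ≤ (G.layer (i + 1 + j)).comap (G.bracket.flip y) := by
        rw [← G.bracket_layer i hi, Submodule.map₂_le]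
        intro a ha b hb
        rw [Submodule.mem_comap, LinearMap.flip_apply, G.bracket_bracket]
        have h1 := G.bracket_one_mem_layer ha (ih hb hy)
        have h2 := ih hb (G.bracket_one_mem_layer ha hy)
        rw [show i + (j + 1) = i + 1 + j by omega] at h2
        rw [show i + j + 1 = i + 1 + j by omega] at h1
        exact sub_mem h1 h2
      exact hle hx

/-- A multiplier with additive weights is a derivation. -/
theorem layerMul_bracket_of_add {c : ℕ → ℝ} (hc : ∀ i j, c (i + j) = c i + c j) (x y : E) :
    G.layerMul c (G.bracket x y)
      = G.bracket (G.layerMul c x) y + G.bracket x (G.layerMul c y) := by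
  have h : G.bracket.compr₂ (G.layerMul c)
      = G.bracket.comp (G.layerMul c) + G.bracket.compl₂ (G.layerMul c) := by
    refine ext_layer (G := G) fun i x hx => ext_layer (G := G) fun j y hy => ?_
    simp [G.layerMul_of_mem c hx, G.layerMul_of_mem c hy,
      G.layerMul_of_mem c (G.bracket_mem_layer hx hy), hc, add_smul]
  exact congrArg (fun T : E →ₗ[ℝ] E →ₗ[ℝ] E => T x y) h

/-- A multiplier with multiplicative weights is an endomorphism. -/
theorem layerMul_bracket_of_mul {c : ℕ → ℝ} (hc : ∀ i j, c (i + j) = c i * c j) (x y : E) :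
    G.layerMul c (G.bracket x y) = G.bracket (G.layerMul c x) (G.layerMul c y) := by
  have h : G.bracket.compr₂ (G.layerMul c) = G.bracket.compl₁₂ (G.layerMul c) (G.layerMul c) := by
    refine ext_layer (G := G) fun i x hx => ext_layer (G := G) fun j y hy => ?_
    simp [G.layerMul_of_mem c hx, G.layerMul_of_mem c hy,
      G.layerMul_of_mem c (G.bracket_mem_layer hx hy), hc, smul_smul, mul_comm]
  exact congrArg (fun T : E →ₗ[ℝ] E →ₗ[ℝ] E => T x y) h

theorem layerMul_layerMul (c d : ℕ → ℝ) (x : E) :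
    G.layerMul c (G.layerMul d x) = G.layerMul (fun i => c i * d i) x := by
  have : G.layerMul c ∘ₗ G.layerMul d = G.layerMul (fun i => c i * d i) :=
    ext_layer (G := G) fun i x hx => by
      simp [G.layerMul_of_mem _ hx, smul_smul, mul_comm]
  exact congrArg (fun T : E →ₗ[ℝ] E => T x) this

theorem layerMul_eq_id {c : ℕ → ℝ} (hc : ∀ i, 1 ≤ i → c i = 1) (x : E) : G.layerMul c x = x := by
  have : G.layerMul c = LinearMap.id :=
    ext_layer (G := G) fun i x hx => by
      rcases Nat.eq_zero_or_pos i with rfl | hi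
      · rw [G.layer_zero, Submodule.mem_bot] at hx
        simp [hx]
      · simp [G.layerMul_of_mem _ hx, hc i hi]
  exact congrArg (fun T : E →ₗ[ℝ] E => T x) this

theorem dilation_eq_layerMul (t : ℝ) : G.dilation t = G.layerMul (fun i => t ^ i) := rfl

theorem dilation_bracket (t : ℝ) (x y : E) :
    G.dilation t (G.bracket x y) = G.bracket (G.dilation t x) (G.dilation t y) :=
  G.layerMul_bracket_of_mul (fun i j => pow_add t i j) x y

theorem dilation_dilation (t u : ℝ) (x : E) :
    G.dilation t (G.dilation u x) = G.dilation (t * u) x := by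
  simp only [dilation_eq_layerMul, layerMul_layerMul, mul_pow]

theorem dilation_one (x : E) : G.dilation 1 x = x := G.layerMul_eq_id (by simp) x

theorem dilation_zero (x : E) : G.dilation 0 x = 0 := by
  simp only [dilation, LinearMap.sum_apply, LinearMap.smul_apply]
  refine Finset.sum_eq_zero fun i hi => ?_
  rw [zero_pow (by have := (Finset.mem_Icc.1 hi).1; omega), zero_smul]

theorem dilation_inv_dilation {t : ℝ} (ht : t ≠ 0) (x : E) :
    G.dilation t⁻¹ (G.dilation t x) = x := by
  rw [dilation_dilation, inv_mul_cancel₀ ht, dilation_one]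

theorem dilation_dilation_inv {t : ℝ} (ht : t ≠ 0) (x : E) :
    G.dilation t (G.dilation t⁻¹ x) = x := by
  rw [dilation_dilation, mul_inv_cancel₀ ht, dilation_one]

/-- The degree derivation, which acts on the `i`-th layer as `i`. -/
def deg : E →ₗ[ℝ] E := G.layerMul (fun i => i)

theorem deg_injective : Function.Injective G.deg := by
  refine Function.LeftInverse.injective (g := G.layerMul (fun i => (i : ℝ)⁻¹)) fun x => ?_
  rw [deg, layerMul_layerMul]
  refine G.layerMul_eq_id (fun i hi => inv_mul_cancel₀ ?_) x
  have : (0 : ℝ) < i := by exact_mod_cast hi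
  exact this.ne'

/-- The terms of the lower central series: `𝔳ₖ ⊕ ⋯ ⊕ 𝔳ₛ`. -/
def fil (k : ℕ) : Submodule ℝ E := ⨆ i, ⨆ _ : k ≤ i, G.layer i

theorem layer_le_fil {k i : ℕ} (h : k ≤ i) : G.layer i ≤ G.fil k :=
  le_iSup₂_of_le i h le_rfl

theorem fil_anti : Antitone G.fil := fun _ _ h =>
  iSup₂_le fun _ hi => G.layer_le_fil (h.trans hi)

theorem fil_one : G.fil 1 = ⊤ := by
  rw [eq_top_iff, ← G.iSup_layer, iSup_le_iff]
  intro i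
  rcases Nat.eq_zero_or_pos i with rfl | hi
  · simp [G.layer_zero]
  · exact G.layer_le_fil hi

theorem mem_fil_one (x : E) : x ∈ G.fil 1 := by rw [fil_one]; trivial

theorem fil_step_succ : G.fil (G.step + 1) = ⊥ := by
  rw [eq_bot_iff]
  exact iSup₂_le fun i hi => (G.layer_eq_bot i (Or.inr hi)).le

theorem fil_le_sup (k : ℕ) : G.fil k ≤ G.layer k ⊔ G.fil (k + 1) := by
  refine iSup₂_le fun i hi => ?_
  rcases hi.eq_or_lt with rfl | h
  · exact le_sup_left
  · exact (G.layer_le_fil h).trans le_sup_right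

theorem bracket_mem_fil {i j : ℕ} {x y : E} (hx : x ∈ G.fil i) (hy : y ∈ G.fil j) :
    G.bracket x y ∈ G.fil (i + j) := by
  have h : G.fil i ≤ (G.fil (i + j)).comap (G.bracket.flip y) := by
    refine iSup₂_le fun i' hi' a ha => ?_
    have h2 : G.fil j ≤ (G.fil (i + j)).comap (G.bracket a) := by
      refine iSup₂_le fun j' hj' b hb => ?_
      exact G.layer_le_fil (by omega) (G.bracket_mem_layer ha hb)
    exact h2 hy
  exact h hx

theorem bracket_mem_fil_succ (x : E) {k : ℕ} {y : E} (hy : y ∈ G.fil k) :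
    G.bracket x y ∈ G.fil (k + 1) := by
  rw [add_comm]
  exact G.bracket_mem_fil (G.mem_fil_one x) hy

/-- An operator that raises the degree is nilpotent. -/
theorem pow_mem_fil {T : Module.End ℝ E} (hT : ∀ k, ∀ x ∈ G.fil k, T x ∈ G.fil (k + 1))
    (n : ℕ) {k : ℕ} {x : E} (hx : x ∈ G.fil k) : (T ^ n) x ∈ G.fil (k + n) := by
  induction n with
  | zero => simpa using hx
  | succ n ih =>
    rw [pow_succ', Module.End.mul_apply]
    exact hT _ _ ih

theorem pow_step_eq_zero {T : Module.End ℝ E} (hT : ∀ k, ∀ x ∈ G.fil k, T x ∈ G.fil (k + 1)) :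
    T ^ G.step = 0 := by
  ext x
  have := G.pow_mem_fil hT G.step (G.mem_fil_one x)
  rwa [add_comm, G.fil_step_succ, Submodule.mem_bot] at this

theorem bracket_pow_step (x : E) : (G.bracket x : Module.End ℝ E) ^ G.step = 0 :=
  G.pow_step_eq_zero fun _ _ hy => G.bracket_mem_fil_succ x hy

open NilpotentSeries Polynomial

theorem expAd_zero : G.expAd (0 : E) = 1 := by
  rw [expAd, ← Nat.sub_add_cancel G.one_le_step, Finset.sum_range_succ']
  simp

theorem expAd_eq_aeval (x : E) {n : ℕ} (hn : G.step ≤ n) :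
    G.expAd x = aeval (G.bracket x : Module.End ℝ E) (expP n) := by
  rw [aeval_expP_eq (pow_eq_zero_of_le hn (G.bracket_pow_step x)) (G.bracket_pow_step x),
    aeval_expP, expAd]

theorem expAd_sub_mem {x y : E} {k : ℕ}
    (hxy : G.bracket x y ∈ G.fil k) : G.expAd x y - y ∈ G.fil k := by
  rw [expAd, ← Nat.sub_add_cancel G.one_le_step, Finset.sum_range_succ']
  simp only [pow_zero, Nat.factorial_zero, Nat.cast_one, inv_one, one_smul, LinearMap.add_apply,
    Module.End.one_apply, add_sub_cancel_right, LinearMap.sum_apply, LinearMap.smul_apply]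
  refine Submodule.sum_mem _ fun n _ => Submodule.smul_mem _ _ ?_
  rw [pow_succ, Module.End.mul_apply]
  exact G.fil_anti (Nat.le_add_right k n)
    (G.pow_mem_fil (fun _ _ hy => G.bracket_mem_fil_succ x hy) n hxy)

theorem expAd_mul_sub_one_mem (x y : E) (k : ℕ) (z : E) (hz : z ∈ G.fil k) :
    (G.expAd x * G.expAd y - 1) z ∈ G.fil (k + 1) := by
  have h1 : ∀ x : E, ∀ z ∈ G.fil k, G.expAd x z - z ∈ G.fil (k + 1) := fun x z hz =>
    G.expAd_sub_mem (G.bracket_mem_fil_succ x hz)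
  have h2 := h1 y z hz
  have h3 : G.expAd y z ∈ G.fil k := by
    have := add_mem (G.fil_anti (Nat.le_succ k) h2) hz
    simpa using this
  have h4 := add_mem (h1 x _ h3) h2
  simpa using h4

theorem psi_eq_aeval (A : Module.End ℝ E) : G.psi A = aeval (A - 1) (psiP G.step) := by
  simp [psi, psiP, Algebra.smul_def]

theorem psi_expAd_eq_aeval (x y : E) {n : ℕ} (hn : G.step ≤ n) :
    G.psi (G.expAd x * G.expAd y) = aeval (G.expAd x * G.expAd y - 1) (psiP n) := by
  rw [psi_eq_aeval]
  exact (aeval_eq_of_dvd (X_pow_dvd_psiP_sub G.one_le_step hn)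
    (G.pow_step_eq_zero (G.expAd_mul_sub_one_mem x y))).symm

theorem psi_sub_mem {T : Module.End ℝ E} {k : ℕ} {y : E}
    (hT : ∀ i, ∀ x ∈ G.fil i, (T - 1) x ∈ G.fil i) (hy : (T - 1) y ∈ G.fil k) :
    G.psi T y - y ∈ G.fil k := by
  simp only [psi, LinearMap.add_apply, Module.End.one_apply, add_sub_cancel_left,
    LinearMap.sum_apply, LinearMap.smul_apply]
  refine Submodule.sum_mem _ fun n hn => Submodule.smul_mem _ _ ?_
  obtain ⟨n, rfl⟩ : ∃ j, n = j + 1 := ⟨n - 1, by have := (Finset.mem_Ico.1 hn).1; omega⟩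
  rw [pow_succ, Module.End.mul_apply]
  clear hn
  induction n with
  | zero => simpa using hy
  | succ n ih =>
    rw [pow_succ', Module.End.mul_apply]
    exact hT _ _ ih

/-- Polynomials in intertwined operators are intertwined. -/
theorem aeval_intertwine {V W : Type*} [AddCommGroup V] [Module ℝ V] [AddCommGroup W] [Module ℝ W]
    {S : Module.End ℝ V} {T : Module.End ℝ W} {ρ : V →ₗ[ℝ] W} (h : ∀ v, T (ρ v) = ρ (S v))
    (P : ℝ[X]) (v : V) : aeval T P (ρ v) = ρ (aeval S P v) := by
  have hp : ∀ (n : ℕ) (v : V), (T ^ n) (ρ v) = ρ ((S ^ n) v) := by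
    intro n
    induction n with
    | zero => simp
    | succ n ih => intro v; rw [pow_succ, pow_succ, Module.End.mul_apply, h, ih]; rfl
  simp [aeval_eq_sum_range, LinearMap.sum_apply, hp]

end Algebra

end CarnotGroup

/-! ### A faithful representation, and the group axioms. -/

namespace CarnotGroup

open NilpotentSeries Polynomial

variable {E : Type*} [NormedAddCommGroup E] [NormedSpace ℝ E] [FiniteDimensional ℝ E]
  (G : CarnotGroup E)

/-- The adjoint action of `E` on its extension `E × ℝ` by the degree derivation. -/
def repLin : E →ₗ[ℝ] (E × ℝ) →ₗ[ℝ] (E × ℝ) :=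
  LinearMap.mk₂ ℝ (fun x w => (G.bracket x w.1 - w.2 • G.deg x, 0))
    (fun x y w => Prod.ext
      (by simp only [map_add, LinearMap.add_apply, smul_add, Prod.fst_add]; abel) (by simp))
    (fun c x w => Prod.ext
      (by simp only [map_smul, LinearMap.smul_apply, smul_sub, Prod.smul_fst, smul_comm w.2 c])
      (by simp))
    (fun x v w => Prod.ext
      (by simp only [map_add, Prod.fst_add, Prod.snd_add, add_smul]; abel) (by simp))
    (fun c x w => Prod.ext
      (by simp only [map_smul, Prod.smul_fst, Prod.smul_snd, smul_sub, smul_eq_mul, mul_smul])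
      (by simp))

/-- A faithful nilpotent representation of the Lie algebra. -/
def rep : E →ₗ[ℝ] ((E × ℝ) →L[ℝ] (E × ℝ)) :=
  LinearMap.toContinuousLinearMap.toLinearMap ∘ₗ G.repLin

theorem rep_apply (x : E) (w : E × ℝ) : G.rep x w = (G.bracket x w.1 - w.2 • G.deg x, 0) := rfl

/-- The adjoint representation alone kills the centre; the vector `(0, 1)` recovers `deg x`, and
`deg` is injective because all weights are positive. -/
theorem rep_injective : Function.Injective G.rep := by
  intro x y h
  have := congrArg (fun T : (E × ℝ) →L[ℝ] (E × ℝ) => (T (0, 1)).1) h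
  simp only [rep_apply, map_zero, one_smul, zero_sub, neg_inj] at this
  exact G.deg_injective this

theorem adR_rep (x y : E) : adR (G.rep x) (G.rep y) = G.rep (G.bracket x y) := by
  have hd := G.layerMul_bracket_of_add (c := fun i => (i : ℝ)) (by intro i j; push_cast; ring) x y
  refine ContinuousLinearMap.ext fun w => ?_
  change G.rep x (G.rep y w) - G.rep y (G.rep x w) = _
  simp only [rep_apply, G.bracket_bracket, map_sub, map_smul, zero_smul, sub_zero]
  rw [deg, hd, G.bracket_skew _ y]
  refine Prod.ext ?_ (by simp)
  simp only [Prod.fst_sub, smul_add, smul_neg]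
  abel

/-- The filtration of `E × ℝ` in which `ℝ` has degree zero. -/
def filExt (k : ℕ) : Submodule ℝ (E × ℝ) := if k = 0 then ⊤ else (G.fil k).prod ⊥

theorem mem_filExt_succ {k : ℕ} {w : E × ℝ} : w ∈ G.filExt (k + 1) ↔ w.1 ∈ G.fil (k + 1) ∧ w.2 = 0 := by
  simp [filExt]

theorem filExt_anti : Antitone G.filExt := by
  refine antitone_nat_of_succ_le fun k w hw => ?_
  rw [mem_filExt_succ] at hw
  cases k with
  | zero => simp [filExt]
  | succ k =>
    rw [mem_filExt_succ]
    exact ⟨G.fil_anti (Nat.le_succ _) hw.1, hw.2⟩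

/-- The operators on `E × ℝ` that raise the degree by at least `k`. -/
def raising (k : ℕ) : Submodule ℝ ((E × ℝ) →L[ℝ] (E × ℝ)) where
  carrier := {T | ∀ i, ∀ w ∈ G.filExt i, T w ∈ G.filExt (i + k)}
  add_mem' ha hb i w hw := add_mem (ha i w hw) (hb i w hw)
  zero_mem' _ _ _ := zero_mem _
  smul_mem' c _ ha i w hw := Submodule.smul_mem _ c (ha i w hw)

theorem isNilFiltration_raising : IsNilFiltration G.raising (G.step + 1) where
  mul_mem := by
    intro i j a b ha hb k w hw
    have := ha _ _ (hb k w hw)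
    rwa [add_assoc, add_comm j i] at this
  one_mem _ _ hw := hw
  anti _ _ h _ hT i w hw := G.filExt_anti (by omega) (hT i w hw)
  bot := by
    rw [eq_bot_iff]
    intro T hT
    rw [Submodule.mem_bot]
    refine ContinuousLinearMap.ext fun w => ?_
    have := hT 0 w (by simp [filExt])
    rw [zero_add, mem_filExt_succ, fil_step_succ, Submodule.mem_bot] at this
    exact Prod.ext this.1 this.2

theorem rep_mem (x : E) : G.rep x ∈ G.raising 1 := by
  intro i w hw
  rw [mem_filExt_succ, rep_apply]
  refine ⟨?_, rfl⟩
  cases i with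
  | zero => exact G.mem_fil_one _
  | succ i =>
    rw [mem_filExt_succ] at hw
    simpa [hw.2] using G.bracket_mem_fil_succ x hw.1

/-- The exponential of the representation, a faithful representation of the group. -/
def grp (x : E) : (E × ℝ) →L[ℝ] (E × ℝ) := aeval (G.rep x) (expP (G.step + 3))

theorem rep_pow_eq_zero (x : E) {n : ℕ} (hn : G.step + 1 ≤ n) : G.rep x ^ n = 0 :=
  G.isNilFiltration_raising.pow_eq_zero (G.rep_mem x) hn

/-- The truncation orders of `grp` and of this logarithm are `m + 2` and `m + 1` with `m = G.step +
1`, the length of the filtration `raising`, as in `exists_log_curve`. -/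
theorem rep_eq_log (x : E) : G.rep x = aeval (G.grp x - 1) (logP (G.step + 2)) :=
  (logP_expP (G.rep_pow_eq_zero x (by omega))).symm

theorem grp_injective : Function.Injective G.grp := by
  intro x y h
  apply G.rep_injective
  rw [rep_eq_log, rep_eq_log, h]

theorem aeval_adR_rep_expP (x v : E) {n : ℕ} (hn : G.step ≤ n) :
    aeval (adR (G.rep x)) (expP n) (G.rep v) = G.rep (G.expAd x v) := by
  rw [aeval_intertwine (S := G.bracket x) (fun v => G.adR_rep x v), G.expAd_eq_aeval x hn]

section Continuity

variable {T : Type*} [TopologicalSpace T]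

theorem continuous_bracket : Continuous fun p : E × E => G.bracket p.1 p.2 := by
  let B : E →L[ℝ] E →L[ℝ] E :=
    LinearMap.toContinuousLinearMap (LinearMap.toContinuousLinearMap.toLinearMap ∘ₗ G.bracket)
  exact (B.continuous.comp continuous_fst).clm_apply continuous_snd

theorem continuous_end_pow {F : T → Module.End ℝ E} (hF : Continuous fun p : T × E => F p.1 p.2)
    (n : ℕ) : Continuous fun p : T × E => (F p.1 ^ n) p.2 := by
  induction n with
  | zero => exact continuous_snd
  | succ n ih =>
    simp only [pow_succ', Module.End.mul_apply]
    exact hF.comp (continuous_fst.prodMk ih)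

theorem continuous_expAd {g : T → E} (hg : Continuous g) :
    Continuous fun p : T × E => G.expAd (g p.1) p.2 := by
  simp only [expAd, LinearMap.sum_apply, LinearMap.smul_apply]
  refine continuous_finsetSum _ fun n _ => Continuous.const_smul ?_ _
  refine continuous_end_pow (F := fun p => G.bracket (g p)) ?_ n
  exact G.continuous_bracket.comp ((hg.comp continuous_fst).prodMk continuous_snd)

theorem continuous_psi {F : T → Module.End ℝ E} (hF : Continuous fun p : T × E => F p.1 p.2) :
    Continuous fun p : T × E => G.psi (F p.1) p.2 := by
  simp only [psi, LinearMap.add_apply, Module.End.one_apply, LinearMap.sum_apply,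
    LinearMap.smul_apply]
  refine continuous_snd.add (continuous_finsetSum _ fun n _ => Continuous.const_smul ?_ _)
  exact continuous_end_pow (F := fun p => F p - 1) (hF.sub continuous_snd) n

theorem continuous_psi_expAd {g h k : T → E} (hg : Continuous g) (hh : Continuous h)
    (hk : Continuous k) : Continuous fun p => G.psi (G.expAd (g p) * G.expAd (h p)) (k p) := by
  have h1 : Continuous fun q : T × E => G.expAd (g q.1) (G.expAd (h q.1) q.2) :=
    (G.continuous_expAd hg).comp (continuous_fst.prodMk (G.continuous_expAd hh))
  have h2 : Continuous fun q : T × E => G.psi (G.expAd (g q.1) * G.expAd (h q.1)) q.2 :=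
    G.continuous_psi (F := fun t => G.expAd (g t) * G.expAd (h t)) h1
  have h3 : Continuous fun p : T => (p, k p) := continuous_id'.prodMk hk
  have h4 := Continuous.comp (g := fun q : T × E => G.psi (G.expAd (g q.1) * G.expAd (h q.1)) q.2)
    (f := fun p : T => (p, k p)) h2 h3
  simpa only [Function.comp_def] using h4

end Continuity

/-- Rescaling the variable moves `t` into the endpoint of the integral, where it can be
differentiated. -/
theorem mul_smul_eq (x y : E) (t : ℝ) :
    G.mul x (t • y) = x + ∫ s in (0 : ℝ)..t, G.psi (G.expAd x * G.expAd (s • y)) y := by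
  have := intervalIntegral.smul_integral_comp_mul_left (a := 0) (b := 1)
    (fun s => G.psi (G.expAd x * G.expAd (s • y)) y) t
  rw [mul_zero, mul_one] at this
  rw [mul, ← this, ← intervalIntegral.integral_smul]
  simp [smul_smul, mul_comm]

theorem hasDerivAt_mul_smul (x y : E) :
    HasDerivAt (fun t : ℝ => G.mul x (t • y)) (G.psi (G.expAd x) y) 0 := by
  have hc : Continuous fun s : ℝ => G.psi (G.expAd x * G.expAd (s • y)) y :=
    G.continuous_psi_expAd continuous_const (by fun_prop) continuous_const
  have h := (hc.integral_hasStrictDerivAt 0 0).hasDerivAt.const_add x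
  simp only [zero_smul, expAd_zero, mul_one] at h
  simpa only [mul_smul_eq] using h

/-- The group law corresponds to the product of operators. -/
theorem grp_mul (x y : E) : G.grp (G.mul x y) = G.grp x * G.grp y := by
  have key := fun t =>
    G.isNilFiltration_raising.exists_log_curve (G.rep_mem x) (G.rep_mem y) t
  simp only at key
  set L : ℝ → (E × ℝ) →L[ℝ] (E × ℝ) := fun s =>
    aeval (aeval (G.rep x) (expP (G.step + 1 + 2))
      * aeval (s • G.rep y) (expP (G.step + 1 + 2)) - 1) (logP (G.step + 1 + 1)) with hL
  -- The velocity of the logarithm `L` is the image under `rep` of the integrand in `mul`.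
  -- Integrating from `0` to `1` therefore gives `L 1 = G.rep (G.mul x y)`.
  have hder : ∀ t : ℝ, HasDerivAt L
      (G.rep (G.psi (G.expAd x * G.expAd (t • y)) y)) t := by
    intro t
    obtain ⟨-, -, -, h4, h5⟩ := key t
    have h6 : ∀ v, aeval (adR (L t)) (expP (G.step + 1 + 2)) (G.rep v)
        = G.rep ((G.expAd x * G.expAd (t • y)) v) := by
      intro v
      rw [h4 _ (G.rep_mem v), ← map_smul, G.aeval_adR_rep_expP _ _ (by omega),
        G.aeval_adR_rep_expP _ _ (by omega)]
      rfl
    rw [G.psi_expAd_eq_aeval x (t • y) (show G.step ≤ G.step + 1 + 2 by omega),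
      ← aeval_intertwine (ρ := G.rep)
        (T := aeval (adR (L t)) (expP (G.step + 1 + 2)) - 1) (fun v => ?_)]
    · exact h5
    · rw [LinearMap.sub_apply, LinearMap.sub_apply, h6, map_sub]
      rfl
  have hc : Continuous fun s : ℝ => G.psi (G.expAd x * G.expAd (s • y)) y :=
    G.continuous_psi_expAd continuous_const (by fun_prop) continuous_const
  let ρ : E →L[ℝ] ((E × ℝ) →L[ℝ] (E × ℝ)) := LinearMap.toContinuousLinearMap G.rep
  have hint := intervalIntegral.integral_eq_sub_of_hasDerivAt (a := 0) (b := 1)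
    (fun t _ => hder t) ((ρ.continuous.comp hc).intervalIntegrable 0 1)
  have hcomm := ρ.intervalIntegral_comp_comm (hc.intervalIntegrable (μ := volume) 0 1)
  obtain ⟨h0, -, -⟩ := key 1
  obtain ⟨-, -, h1, -⟩ := key 1
  have hL1 : L 1 = G.rep (G.mul x y) := by
    rw [mul, map_add, ← h0]
    change _ = L 0 + ρ _
    rw [← hcomm]
    change _ = L 0 + ∫ s in (0 : ℝ)..1, G.rep (G.psi (G.expAd x * G.expAd (s • y)) y)
    rw [hint]; abel
  rw [grp, ← hL1]
  refine h1.trans ?_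
  rw [one_smul]
  rfl

theorem grp_zero : G.grp 0 = 1 := by
  simp [grp, aeval_expP, Finset.sum_range_succ']

theorem mul_assoc (x y z : E) : G.mul (G.mul x y) z = G.mul x (G.mul y z) :=
  G.grp_injective (by simp only [grp_mul, _root_.mul_assoc])

theorem mul_zero (x : E) : G.mul x 0 = x := G.grp_injective (by simp [grp_mul, grp_zero])

theorem zero_mul (x : E) : G.mul 0 x = x := G.grp_injective (by simp [grp_mul, grp_zero])

theorem mul_neg (x : E) : G.mul x (-x) = 0 :=
  G.grp_injective (by
    rw [grp_mul, grp_zero, grp, grp, map_neg]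
    exact expP_mul_neg (G.rep_pow_eq_zero x (by omega)))

theorem neg_mul (x : E) : G.mul (-x) x = 0 := by simpa using G.mul_neg (-x)

theorem neg_mul_cancel (x y : E) : G.mul (-x) (G.mul x y) = y := by
  rw [← mul_assoc, neg_mul, zero_mul]

theorem mul_neg_cancel (x y : E) : G.mul x (G.mul (-x) y) = y := by
  rw [← mul_assoc, mul_neg, zero_mul]

theorem mul_neg_cancel_right (x y : E) : G.mul (G.mul x (-y)) y = x := by
  rw [mul_assoc, neg_mul, mul_zero]

theorem neg_mul_rev (x y : E) : -G.mul x y = G.mul (-y) (-x) := by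
  have h : G.mul (G.mul x y) (G.mul (-y) (-x)) = 0 := by
    rw [G.mul_assoc x, mul_neg_cancel, mul_neg]
  rw [← G.neg_mul_cancel (G.mul x y) (G.mul (-y) (-x)), h, mul_zero]

theorem mul_smul_smul (x : E) (s t : ℝ) : G.mul (s • x) (t • x) = (s + t) • x := by
  apply G.grp_injective
  rw [grp_mul, grp, grp, grp, add_smul, map_add]
  refine (expP_add ?_ ?_ ?_ ?_).symm
  · rw [map_smul, map_smul]
    exact ((Commute.refl (G.rep x)).smul_left s).smul_right t
  all_goals first
    | exact G.rep_pow_eq_zero _ (by omega)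
    | (rw [← map_add]; exact G.rep_pow_eq_zero _ (by omega))

/-- Conjugation is the exponential of the adjoint representation. -/
theorem mul_mul_neg (x y : E) : G.mul (G.mul x y) (-x) = G.expAd x y := by
  apply G.grp_injective
  have h1 : G.rep (G.expAd x y) = G.grp x * G.rep y * G.grp (-x) := by
    rw [← G.aeval_adR_rep_expP x y (show G.step ≤ G.step + 3 by omega),
      G.isNilFiltration_raising.expP_adR (G.rep_mem x) (G.rep_mem y) (by omega), grp, grp, map_neg]
  have hinv : G.grp (-x) * G.grp x = 1 := by rw [← grp_mul, neg_mul, grp_zero]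
  have hinv' : G.grp x * G.grp (-x) = 1 := by rw [← grp_mul, mul_neg, grp_zero]
  have h2 : ∀ k, (G.rep (G.expAd x y)) ^ k = G.grp x * G.rep y ^ k * G.grp (-x) := by
    intro k
    rw [h1]
    induction k with
    | zero => simp [hinv']
    | succ k ih =>
      rw [pow_succ, ih, pow_succ]
      calc _ = G.grp x * G.rep y ^ k * (G.grp (-x) * G.grp x) * G.rep y * G.grp (-x) := by
            simp only [_root_.mul_assoc]
        _ = _ := by rw [hinv]; simp only [_root_.mul_assoc, _root_.mul_one]
  rw [grp_mul, grp_mul]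
  change G.grp x * aeval (G.rep y) (expP (G.step + 3)) * G.grp (-x)
    = aeval (G.rep (G.expAd x y)) (expP (G.step + 3))
  simp only [aeval_expP, h2, Finset.mul_sum, Finset.sum_mul, mul_smul_comm, smul_mul_assoc]

theorem dilation_expAd (t : ℝ) (x y : E) :
    G.dilation t (G.expAd x y) = G.expAd (G.dilation t x) (G.dilation t y) := by
  have h : ∀ n : ℕ, ∀ y, G.dilation t (((G.bracket x : Module.End ℝ E) ^ n) y)
      = ((G.bracket (G.dilation t x) : Module.End ℝ E) ^ n) (G.dilation t y) := by
    intro n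
    induction n with
    | zero => simp
    | succ n ih =>
      intro y
      rw [pow_succ, pow_succ, Module.End.mul_apply, ih, dilation_bracket]
      rfl
  simp [expAd, h]

theorem dilation_mul (t : ℝ) (x y : E) :
    G.dilation t (G.mul x y) = G.mul (G.dilation t x) (G.dilation t y) := by
  have h : ∀ (A B : Module.End ℝ E), (∀ v, G.dilation t (A v) = B (G.dilation t v)) →
      ∀ v, G.dilation t (G.psi A v) = G.psi B (G.dilation t v) := by
    intro A B hAB v
    rw [psi_eq_aeval, psi_eq_aeval]
    refine (aeval_intertwine (fun v => ?_) _ _).symm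
    simp [hAB]
  have hc : Continuous fun s : ℝ => G.psi (G.expAd x * G.expAd (s • y)) y :=
    G.continuous_psi_expAd continuous_const (by fun_prop) continuous_const
  have hcomm := (LinearMap.toContinuousLinearMap (G.dilation t)).intervalIntegral_comp_comm
    (hc.intervalIntegrable (μ := volume) 0 1)
  simp only [LinearMap.coe_toContinuousLinearMap'] at hcomm
  rw [mul, mul, map_add, ← hcomm]
  congr 1
  refine intervalIntegral.integral_congr fun s _ => h _ _ (fun v => ?_) _
  simp [dilation_expAd]

theorem contDiff_aeval {V A : Type*} [NormedAddCommGroup V] [NormedSpace ℝ V] [NormedRing A]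
    [NormedAlgebra ℝ A] {g : V → A} (hg : ContDiff ℝ 1 g) (P : ℝ[X]) :
    ContDiff ℝ 1 fun v => aeval (g v) P := by
  simp only [aeval_eq_sum_range]
  exact ContDiff.sum fun n _ => (hg.pow n).const_smul _

/-- The product is the logarithm, a polynomial, of a product of operators, followed by a linear left
inverse of `rep`; the integral is never differentiated. -/
theorem contDiff_mul : ContDiff ℝ 1 fun p : E × E => G.mul p.1 p.2 := by
  obtain ⟨r, hr⟩ := G.rep.exists_leftInverse_of_injective
    (LinearMap.ker_eq_bot.2 G.rep_injective)
  have h : (fun p : E × E => G.mul p.1 p.2) = fun p =>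
      LinearMap.toContinuousLinearMap r
        (aeval (G.grp p.1 * G.grp p.2 - 1) (logP (G.step + 2))) := by
    funext p
    rw [← grp_mul, ← rep_eq_log]
    exact (congrArg (fun T : E →ₗ[ℝ] E => T (G.mul p.1 p.2)) hr).symm
  have hg : ContDiff ℝ 1 G.grp :=
    contDiff_aeval (LinearMap.toContinuousLinearMap G.rep).contDiff _
  rw [h]
  refine (ContinuousLinearMap.contDiff _).comp (contDiff_aeval ?_ _)
  exact ((hg.comp contDiff_fst).mul (hg.comp contDiff_snd)).sub contDiff_const

theorem continuous_mul : Continuous fun p : E × E => G.mul p.1 p.2 := G.contDiff_mul.continuous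

end CarnotGroup

/-! ### Haar measure, dilations and homogeneous norms. -/

namespace CarnotGroup

variable {E : Type*} [NormedAddCommGroup E] [NormedSpace ℝ E]

theorem continuous_dilation_left (G : CarnotGroup E) (x : E) :
    Continuous fun t : ℝ => G.dilation t x := by
  simp only [dilation, LinearMap.sum_apply, LinearMap.smul_apply]
  fun_prop

variable [FiniteDimensional ℝ E] (G : CarnotGroup E)

theorem continuous_dilation (t : ℝ) : Continuous (G.dilation t) :=
  LinearMap.continuous_of_finiteDimensional _

theorem det_dilation (t : ℝ) : LinearMap.det (G.dilation t) = t ^ G.homDim := by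
  classical
  let v : ∀ i, Module.Basis (Fin (Module.finrank ℝ (G.layer i))) ℝ (G.layer i) :=
    fun i => Module.finBasis ℝ (G.layer i)
  let b := G.isInternal.collectedBasis v
  have : Fintype (Σ i, Fin (Module.finrank ℝ (G.layer i))) := Module.Basis.fintypeIndexOfRankLtAleph0 b
    (Module.rank_lt_aleph0 ℝ E)
  have hb : ∀ a, G.dilation t (b a) = t ^ a.1 • b a := fun a =>
    G.dilation_of_mem (G.isInternal.collectedBasis_mem v a) t
  have hm : LinearMap.toMatrix b b (G.dilation t) = Matrix.diagonal fun a => t ^ a.1 := by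
    ext a a'
    rw [LinearMap.toMatrix_apply, hb, map_smul, Finsupp.smul_apply, b.repr_self,
      Matrix.diagonal_apply, Finsupp.single_apply]
    by_cases h : a' = a
    · simp [h]
    · simp [h, Ne.symm h]
  rw [← LinearMap.det_toMatrix b, hm, Matrix.det_diagonal, Finset.prod_pow_eq_pow_sum, homDim]
  congr 1
  -- Layers outside `1, …, s` are zero and contribute no basis vectors.
  have hu : (Finset.univ : Finset (Σ i, Fin (Module.finrank ℝ (G.layer i))))
      = (Finset.Icc 1 G.step).sigma fun i => Finset.univ := by
    ext ⟨i, j⟩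
    simp only [Finset.mem_univ, Finset.mem_sigma, and_true, true_iff]
    by_contra hi
    have h0 : G.layer i = ⊥ := G.layer_eq_bot i (by rw [Finset.mem_Icc] at hi; omega)
    have h1 : Module.finrank ℝ (G.layer i) = 0 := by rw [h0, finrank_bot]
    have := j.2
    omega
  rw [hu, Finset.sum_sigma]
  refine Finset.sum_congr rfl fun i _ => ?_
  simp [mul_comm]

theorem one_le_homDim : 1 ≤ G.homDim := by
  have h1 : 1 ∈ Finset.Icc 1 G.step := Finset.mem_Icc.2 ⟨le_rfl, G.one_le_step⟩
  have h2 : 1 ≤ 1 * Module.finrank ℝ (G.layer 1) := by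
    rw [one_mul]
    exact Submodule.one_le_finrank_iff.2 (G.layer_ne_bot 1 le_rfl G.one_le_step)
  exact h2.trans (Finset.single_le_sum (f := fun i => i * Module.finrank ℝ (G.layer i))
    (fun i _ => Nat.zero_le _) h1)

section Translation

/-- The differential of left translation by `p.1` at `p.2`. -/
def leftDiff (p : E × E) : E →L[ℝ] E :=
  (fderiv ℝ (fun p : E × E => G.mul p.1 p.2) p).comp (ContinuousLinearMap.inr ℝ E E)

theorem hasFDerivAt_mul_left (x y : E) : HasFDerivAt (G.mul x) (G.leftDiff (x, y)) y := by
  have h := ((G.contDiff_mul.differentiable one_ne_zero) (x, y)).hasFDerivAt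
  exact h.comp y (hasFDerivAt_prodMk_right x y)

/-- Conjugation by `δ_t` moves both base points to their dilates without changing the Jacobian. As
`t` tends to `0` it tends to the Jacobian of translation by `0`, which is the identity. -/
theorem det_leftDiff (p : E × E) : (G.leftDiff p).det = 1 := by
  have hinv : ∀ t : ℝ, t ≠ 0 →
      (G.leftDiff (G.dilation t p.1, G.dilation t p.2)).det = (G.leftDiff p).det := by
    intro t ht
    let δ : E →L[ℝ] E := LinearMap.toContinuousLinearMap (G.dilation t)
    have h1 : HasFDerivAt (fun y => G.mul (G.dilation t p.1) (δ y))
        ((G.leftDiff (G.dilation t p.1, G.dilation t p.2)).comp δ) p.2 :=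
      (G.hasFDerivAt_mul_left (G.dilation t p.1) (δ p.2)).comp p.2 δ.hasFDerivAt
    have h2 : HasFDerivAt (fun y => δ (G.mul p.1 y)) (δ.comp (G.leftDiff p)) p.2 :=
      δ.hasFDerivAt.comp p.2 (G.hasFDerivAt_mul_left p.1 p.2)
    have h3 : (fun y => δ (G.mul p.1 y)) = fun y => G.mul (G.dilation t p.1) (δ y) :=
      funext fun y => G.dilation_mul t p.1 y
    rw [h3] at h2
    have h4 := congrArg (fun T : E →L[ℝ] E => LinearMap.det (T : E →ₗ[ℝ] E)) (h1.unique h2)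
    simp only [ContinuousLinearMap.toLinearMap_comp, LinearMap.det_comp] at h4
    have h5 : LinearMap.det (δ : E →ₗ[ℝ] E) ≠ 0 := by
      change LinearMap.det (G.dilation t) ≠ 0
      rw [det_dilation]
      exact pow_ne_zero _ ht
    rw [mul_comm] at h4
    exact mul_left_cancel₀ h5 h4
  have hcont : Continuous fun t : ℝ => (G.leftDiff (G.dilation t p.1, G.dilation t p.2)).det := by
    have h1 : Continuous G.leftDiff :=
      (G.contDiff_mul.continuous_fderiv one_ne_zero).clm_comp continuous_const
    exact ContinuousLinearMap.continuous_det.comp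
      (h1.comp ((G.continuous_dilation_left p.1).prodMk (G.continuous_dilation_left p.2)))
  have hlim : Filter.Tendsto
      (fun t : ℝ => (G.leftDiff (G.dilation t p.1, G.dilation t p.2)).det) (𝓝[≠] 0)
      (𝓝 (G.leftDiff p).det) := by
    refine tendsto_const_nhds.congr' ?_
    filter_upwards [self_mem_nhdsWithin] with t ht
    exact (hinv t ht).symm
  have h0 := tendsto_nhds_unique hlim ((hcont.tendsto 0).mono_left nhdsWithin_le_nhds)
  rw [h0, dilation_zero, dilation_zero]
  have h1 : HasFDerivAt (fun y : E => y) (G.leftDiff (0, 0)) 0 := by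
    have := G.hasFDerivAt_mul_left 0 0
    rwa [show G.mul 0 = fun y => y from funext G.zero_mul] at this
  rw [h1.unique (hasFDerivAt_id 0)]
  exact LinearMap.det_id

variable [MeasurableSpace E] [BorelSpace E] (μ : Measure E) [μ.IsAddHaarMeasure]

theorem measure_mul_left_image (x : E) {s : Set E} (hs : MeasurableSet s) :
    μ (G.mul x '' s) = μ s := by
  rw [← lintegral_abs_det_fderiv_eq_addHaar_image μ hs
    (fun y _ => (G.hasFDerivAt_mul_left x y).hasFDerivWithinAt)
    (Function.LeftInverse.injective (G.neg_mul_cancel x)).injOn]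
  simp [det_leftDiff]

/-- Right translation is left translation conjugated by the inversion `y ↦ -y`, which preserves `μ`.
-/
theorem measure_mul_right_image (x : E) {s : Set E} (hs : MeasurableSet s) :
    μ ((fun y => G.mul y x) '' s) = μ s := by
  have h : (fun y => G.mul y x) '' s = -(G.mul (-x) '' (-s)) := by
    ext z
    simp only [Set.mem_image, Set.mem_neg]
    constructor
    · rintro ⟨y, hy, rfl⟩
      exact ⟨-y, by simpa using hy, (G.neg_mul_rev y x).symm⟩
    · rintro ⟨y, hy, h⟩
      exact ⟨-y, hy, by rw [← neg_neg z, ← h, neg_mul_rev, neg_neg]⟩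
  rw [h, Measure.measure_neg, G.measure_mul_left_image μ _ hs.neg, Measure.measure_neg]

theorem measure_dilation_image {t : ℝ} (ht : 0 ≤ t) (s : Set E) :
    μ (G.dilation t '' s) = ENNReal.ofReal t ^ G.homDim * μ s := by
  rw [Measure.addHaar_image_linearMap, det_dilation, abs_of_nonneg (by positivity),
    ENNReal.ofReal_pow ht]

end Translation

theorem dilation_of_mem_layer_one {x : E} (hx : x ∈ G.layer 1) (t : ℝ) :
    G.dilation t x = t • x := by
  simpa using G.dilation_of_mem hx t

namespace IsHomogeneousNorm

variable {G} {N : E → ℝ} (hN : G.IsHomogeneousNorm N)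

include hN

theorem zero : N 0 = 0 := (hN.eq_zero_iff 0).2 rfl

theorem pos {x : E} (hx : x ≠ 0) : 0 < N x :=
  lt_of_le_of_ne (hN.nonneg x) fun h => hx ((hN.eq_zero_iff x).1 h.symm)

theorem dilation' {t : ℝ} (ht : 0 ≤ t) (x : E) : N (G.dilation t x) = t * N x := by
  rcases ht.eq_or_lt with rfl | ht
  · rw [dilation_zero, hN.zero, MulZeroClass.zero_mul]
  · exact hN.dilation t ht x

/-- Points with small homogeneous norm are in the unit ball. -/
theorem exists_norm_le_one : ∃ c > 0, ∀ x, N x < c → ‖x‖ ≤ 1 := by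
  obtain ⟨z, -, hz⟩ := Submodule.exists_mem_ne_zero_of_ne_bot (G.layer_ne_bot 1 le_rfl G.one_le_step)
  have : Nontrivial E := ⟨⟨z, 0, hz⟩⟩
  obtain ⟨y, hy, hmin⟩ := (isCompact_sphere (0 : E) 1).exists_isMinOn
    (NormedSpace.sphere_nonempty.2 zero_le_one) hN.continuous.continuousOn
  have hy0 : y ≠ 0 := by
    rintro rfl
    simp at hy
  refine ⟨N y, hN.pos hy0, fun x hx => ?_⟩
  by_contra! h
  -- A point outside the unit ball can be shrunk onto the unit sphere by a dilation with `t ≤ 1`,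
  -- which does not increase `N`; on the sphere `N` is at least `N y`.
  obtain ⟨t, ht, htx⟩ : ∃ t ∈ Set.Icc (0 : ℝ) 1, ‖G.dilation t x‖ = 1 := by
    refine intermediate_value_Icc zero_le_one (G.continuous_dilation_left x).norm.continuousOn ?_
    simp [dilation_zero, dilation_one, h.le]
  have h1 : N y ≤ N (G.dilation t x) := hmin (by simpa using htx)
  rw [hN.dilation' ht.1] at h1
  have : t * N x ≤ 1 * N x := mul_le_mul_of_nonneg_right ht.2 (hN.nonneg x)
  linarith

theorem isCompact_sublevel (r : ℝ) : IsCompact {x | N x ≤ r} := by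
  obtain ⟨c, hc, h⟩ := hN.exists_norm_le_one
  -- Chosen so that `t * (|r| + 1) = c / 2 < c`; the dilation by `t` then sends the sublevel set
  -- into the unit ball.
  set t : ℝ := c / (2 * (|r| + 1)) with ht
  have ht0 : 0 < t := by positivity
  have hsub : {x | N x ≤ r} ⊆ G.dilation t⁻¹ '' Metric.closedBall 0 1 := by
    intro x hx
    refine ⟨G.dilation t x, ?_, G.dilation_inv_dilation ht0.ne' x⟩
    rw [mem_closedBall_zero_iff]
    apply h
    rw [hN.dilation t ht0]
    have h1 : N x ≤ |r| + 1 := by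
      have := le_abs_self r
      have hx' : N x ≤ r := hx
      linarith
    calc t * N x ≤ t * (|r| + 1) := by gcongr
      _ = c / 2 := by rw [ht]; field_simp
      _ < c := by linarith
  exact ((isCompact_closedBall (0 : E) 1).image (G.continuous_dilation _)).of_isClosed_subset
    (isClosed_le hN.continuous continuous_const) hsub

/-- The quasi-triangle inequality. -/
theorem exists_mul_le : ∃ C : ℝ, 0 < C ∧ ∀ r x y, N x ≤ r → N y ≤ r → N (G.mul x y) ≤ C * r := by
  have hK := (hN.isCompact_sublevel 1).prod (hN.isCompact_sublevel 1)
  obtain ⟨C, hC⟩ := hK.bddAbove_image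
    (hN.continuous.comp G.continuous_mul).continuousOn
  refine ⟨max C 1, by positivity, fun r x y hx hy => ?_⟩
  rcases (hN.nonneg x |>.trans hx).eq_or_lt with rfl | hr
  · have hx0 := (hN.eq_zero_iff x).1 (le_antisymm hx (hN.nonneg x))
    have hy0 := (hN.eq_zero_iff y).1 (le_antisymm hy (hN.nonneg y))
    simp [hx0, hy0, G.mul_zero, hN.zero]
  · have hx' : N (G.dilation r⁻¹ x) ≤ 1 := by
      rw [hN.dilation _ (inv_pos.2 hr), inv_mul_le_iff₀ hr]; simpa using hx
    have hy' : N (G.dilation r⁻¹ y) ≤ 1 := by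
      rw [hN.dilation _ (inv_pos.2 hr), inv_mul_le_iff₀ hr]; simpa using hy
    have h1 : N (G.mul (G.dilation r⁻¹ x) (G.dilation r⁻¹ y)) ≤ C :=
      hC ⟨(G.dilation r⁻¹ x, G.dilation r⁻¹ y), ⟨hx', hy'⟩, rfl⟩
    rw [← dilation_mul, hN.dilation _ (inv_pos.2 hr), inv_mul_le_iff₀ hr] at h1
    rw [mul_comm]
    exact h1.trans (by gcongr; exact le_max_left _ _)

theorem measure_sublevel [MeasurableSpace E] [BorelSpace E] (μ : Measure E) [μ.IsAddHaarMeasure]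
    {r : ℝ} (hr : 0 < r) : μ {x | N x ≤ r} = ENNReal.ofReal r ^ G.homDim * μ {x | N x ≤ 1} := by
  rw [← G.measure_dilation_image μ hr.le]
  congr 1
  ext x
  simp only [Set.mem_ofPred_eq, Set.mem_image]
  constructor
  · intro hx
    refine ⟨G.dilation r⁻¹ x, ?_, G.dilation_dilation_inv hr.ne' x⟩
    rw [hN.dilation _ (inv_pos.2 hr), inv_mul_le_iff₀ hr]; simpa using hx
  · rintro ⟨y, hy, rfl⟩
    rw [hN.dilation r hr]
    nlinarith

end IsHomogeneousNorm

end CarnotGroup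

/-! ### Chow's theorem: horizontal directions reach every point at controlled cost. -/

namespace CarnotGroup

variable {E : Type*} [NormedAddCommGroup E] [NormedSpace ℝ E] [FiniteDimensional ℝ E]
  (G : CarnotGroup E)

theorem intervalIntegral_mem (S : Submodule ℝ E) {f : ℝ → E} (hf : Continuous f)
    (hS : ∀ t, f t ∈ S) (a b : ℝ) : ∫ t in a..b, f t ∈ S := by
  have hg : Continuous fun t => (⟨f t, hS t⟩ : S) := hf.subtype_mk hS
  have h := S.subtypeL.intervalIntegral_comp_comm (hg.intervalIntegrable (μ := volume) a b)
  have h' : ∫ t in a..b, f t = S.subtypeL (∫ t in a..b, (⟨f t, hS t⟩ : S)) := h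
  rw [h']
  exact Submodule.coe_mem _

theorem expAd_self (t : ℝ) (x : E) : G.expAd (t • x) x = x := by
  have h := G.expAd_sub_mem (x := t • x) (y := x) (k := G.step + 1) (by simp [G.bracket_self])
  rwa [fil_step_succ, Submodule.mem_bot, sub_eq_zero] at h

/-- The group law is addition up to the order of the bracket. -/
theorem mul_sub_add_mem {x y : E} {k : ℕ} (h : G.bracket x y ∈ G.fil k) :
    G.mul x y - (x + y) ∈ G.fil k := by
  have hc : Continuous fun s : ℝ => G.psi (G.expAd x * G.expAd (s • y)) y :=
    G.continuous_psi_expAd continuous_const (by fun_prop) continuous_const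
  have h1 : G.mul x y - (x + y)
      = ∫ s in (0 : ℝ)..1, (G.psi (G.expAd x * G.expAd (s • y)) y - y) := by
    rw [intervalIntegral.integral_sub (hc.intervalIntegrable _ _)
      (continuous_const.intervalIntegrable _ _), mul]
    simp
  rw [h1]
  refine intervalIntegral_mem _ (hc.sub continuous_const) (fun s => ?_) _ _
  refine G.psi_sub_mem (fun i z hz => ?_) ?_
  · exact G.fil_anti (Nat.le_succ i) (G.expAd_mul_sub_one_mem _ _ i z hz)
  · rw [LinearMap.sub_apply, Module.End.mul_apply, expAd_self]
    exact G.expAd_sub_mem h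

theorem mul_sub_add_mem_of_mem {x y : E} {k : ℕ} (hk : 1 ≤ k) (hx : x ∈ G.fil k)
    (hy : y ∈ G.fil k) : G.mul x y - (x + y) ∈ G.fil (k + 1) :=
  G.mul_sub_add_mem (G.fil_anti (by omega) (G.bracket_mem_fil hx hy))

theorem expAd_sub_sub_mem (x : E) {k : ℕ} {y : E} (hy : y ∈ G.fil k) :
    G.expAd x y - y - G.bracket x y ∈ G.fil (k + 2) := by
  rw [G.expAd_eq_aeval x (show G.step ≤ G.step + 2 by omega), NilpotentSeries.aeval_expP,
    Finset.sum_range_succ', Finset.sum_range_succ']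
  simp only [zero_add, Nat.factorial_one, Nat.factorial_zero, Nat.cast_one, inv_one, one_smul,
    pow_one, pow_zero, LinearMap.add_apply, Module.End.one_apply, add_sub_cancel_right,
    LinearMap.sum_apply, LinearMap.smul_apply]
  refine Submodule.sum_mem _ fun n _ => Submodule.smul_mem _ _ ?_
  exact G.fil_anti (by omega)
    (G.pow_mem_fil (fun _ _ hy => G.bracket_mem_fil_succ x hy) (n + 1 + 1) hy)

/-- The group commutator is the bracket up to higher order. -/
theorem commutator_sub_mem (x : E) {k : ℕ} (hk : 1 ≤ k) {y : E} (hy : y ∈ G.fil k) :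
    G.mul (G.expAd x y) (-y) - G.bracket x y ∈ G.fil (k + 2) := by
  have h1 := G.expAd_sub_sub_mem x hy
  have h2 : G.expAd x y - y ∈ G.fil (k + 1) := G.expAd_sub_mem (G.bracket_mem_fil_succ x hy)
  have h3 : G.bracket (G.expAd x y) (-y) ∈ G.fil (k + 2) := by
    have : G.bracket (G.expAd x y) (-y) = - G.bracket (G.expAd x y - y) y := by
      simp [G.bracket_self]
    rw [this]
    exact neg_mem (G.fil_anti (by omega) (G.bracket_mem_fil h2 hy))
  have h4 := add_mem (G.mul_sub_add_mem h3) h1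
  convert h4 using 1
  abel

theorem layerMul_mem_fil (c : ℕ → ℝ) {k : ℕ} {x : E} (hx : x ∈ G.fil k) :
    G.layerMul c x ∈ G.fil k := by
  have h : G.fil k ≤ (G.fil k).comap (G.layerMul c) := by
    refine iSup₂_le fun i hi a ha => ?_
    rw [Submodule.mem_comap, G.layerMul_of_mem c ha]
    exact Submodule.smul_mem _ _ (G.layer_le_fil hi ha)
  exact h hx

/-- A continuous function that is `1`-Lipschitz along horizontal segments. -/
def IsHorizLipschitz (f : E → ℝ) : Prop :=
  Continuous f ∧ ∀ x ∈ G.layer 1, ∀ p, |f (G.mul p x) - f p| ≤ ‖x‖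

/-- Right translation by `g` changes no function that is `1`-Lipschitz along horizontal segments
by more than `C`. This says that the Carnot-Caratheodory length of `g` is at most `C`. -/
def Reach (C : ℝ) (g : E) : Prop :=
  ∀ f, G.IsHorizLipschitz f → ∀ p, |f (G.mul p g) - f p| ≤ C

variable {G}

theorem Reach.mul {C D : ℝ} {g h : E} (hg : G.Reach C g) (hh : G.Reach D h) :
    G.Reach (C + D) (G.mul g h) := fun f hf p => by
  rw [← G.mul_assoc]
  have h1 := hg f hf p
  have h2 := hh f hf (G.mul p g)
  have := abs_sub_le (f (G.mul (G.mul p g) h)) (f (G.mul p g)) (f p)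
  linarith

theorem Reach.neg {C : ℝ} {g : E} (hg : G.Reach C g) : G.Reach C (-g) := fun f hf p => by
  have h1 := hg f hf (G.mul p (-g))
  rwa [G.mul_neg_cancel_right, abs_sub_comm] at h1

theorem reach_zero : G.Reach 0 (0 : E) := fun f _ p => by simp [G.mul_zero]

theorem reach_of_mem_layer_one {x : E} (hx : x ∈ G.layer 1) : G.Reach ‖x‖ x :=
  fun _ hf p => hf.2 x hx p

/-- The test function `t⁻¹ * f ∘ δ_t` is again admissible, because `δ_t` is multiplication by `t` on
the first layer. -/
theorem Reach.dilation {C : ℝ} {g : E} (hg : G.Reach C g) {t : ℝ} (ht : 0 < t) :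
    G.Reach (t * C) (G.dilation t g) := fun f hf p => by
  have hf' : G.IsHorizLipschitz fun p => t⁻¹ * f (G.dilation t p) := by
    refine ⟨(hf.1.comp (G.continuous_dilation t)).const_mul _, fun x hx q => ?_⟩
    rw [← mul_sub, abs_mul, abs_of_pos (inv_pos.2 ht), inv_mul_le_iff₀ ht, dilation_mul,
      G.dilation_of_mem_layer_one hx]
    have := hf.2 (t • x) (Submodule.smul_mem _ _ hx) (G.dilation t q)
    rwa [norm_smul, Real.norm_of_nonneg ht.le] at this
  have h1 := hg _ hf' (G.dilation t⁻¹ p)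
  rw [← mul_sub, abs_mul, abs_of_pos (inv_pos.2 ht), inv_mul_le_iff₀ ht, dilation_mul,
    G.dilation_dilation_inv ht.ne'] at h1
  exact h1

theorem Reach.commutator {C D : ℝ} {x y : E} (hx : G.Reach C x) (hy : G.Reach D y) :
    G.Reach (C + D + C + D) (G.mul (G.expAd x y) (-y)) := by
  rw [← G.mul_mul_neg]
  exact ((hx.mul hy).mul hx.neg).mul hy.neg

variable (G) in
/-- The elements of the `k`-th layer that agree with a reachable element up to higher order. -/
def reachLayer (k : ℕ) (hk : 1 ≤ k) : Submodule ℝ E where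
  carrier := {y | y ∈ G.layer k ∧ ∃ C z, G.Reach C z ∧ z - y ∈ G.fil (k + 1)}
  zero_mem' := ⟨zero_mem _, 0, 0, reach_zero, by simp⟩
  add_mem' := by
    rintro a b ⟨ha, C, z, hz, hza⟩ ⟨hb, D, w, hw, hwb⟩
    refine ⟨add_mem ha hb, C + D, G.mul z w, hz.mul hw, ?_⟩
    have hzk : z ∈ G.fil k := by
      have := add_mem (G.fil_anti (Nat.le_succ k) hza) (G.layer_le_fil le_rfl ha)
      simpa using this
    have hwk : w ∈ G.fil k := by
      have := add_mem (G.fil_anti (Nat.le_succ k) hwb) (G.layer_le_fil le_rfl hb)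
      simpa using this
    have := add_mem (G.mul_sub_add_mem_of_mem hk hzk hwk) (add_mem hza hwb)
    convert this using 1
    abel
  smul_mem' := by
    -- The dilation by `c ^ (1 / k)` multiplies the `k`-th layer by `c`. Negative scalars are
    -- handled through the inverse `-z`.
    have hpos : ∀ c : ℝ, 0 < c → ∀ y ∈ G.layer k, ∀ C z, G.Reach C z → z - y ∈ G.fil (k + 1) →
        ∃ C w, G.Reach C w ∧ w - c • y ∈ G.fil (k + 1) := by
      intro c hc y hy C z hz hzy
      have ht : 0 < c ^ (k : ℝ)⁻¹ := Real.rpow_pos_of_pos hc _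
      refine ⟨_, _, hz.dilation ht, ?_⟩
      have h1 := G.layerMul_mem_fil (fun i => (c ^ (k : ℝ)⁻¹) ^ i) hzy
      rw [← dilation_eq_layerMul, map_sub, G.dilation_of_mem hy,
        Real.rpow_inv_natCast_pow hc.le (by omega)] at h1
      exact h1
    rintro c y ⟨hy, C, z, hz, hzy⟩
    refine ⟨Submodule.smul_mem _ _ hy, ?_⟩
    rcases lt_trichotomy c 0 with hc | rfl | hc
    · have h1 : -z - -y ∈ G.fil (k + 1) := by
        have := neg_mem hzy
        convert this using 1
        abel
      simpa using hpos (-c) (neg_pos.2 hc) (-y) (neg_mem hy) C (-z) hz.neg h1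
    · exact ⟨0, 0, reach_zero, by simp⟩
    · exact hpos c hc y hy C z hz hzy

/-- Brackets `[x, y]` with `x` horizontal span the next layer. If `z` is reachable with leading part
`y`, the group commutator of `x` and `z` is reachable with leading part `[x, y]`. -/
theorem layer_le_reachLayer (k : ℕ) (hk : 1 ≤ k) : G.layer k ≤ G.reachLayer k hk := by
  induction k, hk using Nat.le_induction with
  | base => exact fun x hx => ⟨hx, ‖x‖, x, reach_of_mem_layer_one hx, by simp⟩
  | succ k hk ih =>
    rw [← G.bracket_layer k hk, Submodule.map₂_le]
    intro x hx y hy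
    obtain ⟨-, D, z, hz, hzy⟩ := ih hy
    have hyk := G.layer_le_fil le_rfl hy
    have hzk : z ∈ G.fil k := by
      have := add_mem (G.fil_anti (Nat.le_succ k) hzy) hyk
      simpa using this
    refine ⟨G.bracket_one_mem_layer hx hy, _, _, (reach_of_mem_layer_one hx).commutator hz, ?_⟩
    have h1 := G.commutator_sub_mem x hk hzk
    have h2 := G.bracket_mem_fil_succ x hzy
    have := add_mem h1 h2
    rw [map_sub] at this
    convert this using 1
    abel

/-- Dividing `x` by a reachable element with the same leading part raises its order by one. Here `j`
bounds the number of orders left before the filtration ends. -/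
theorem exists_reach_of_mem_fil (j : ℕ) : ∀ k, 1 ≤ k → G.step + 1 ≤ k + j → ∀ x ∈ G.fil k,
    ∃ C, G.Reach C x := by
  induction j with
  | zero =>
    intro k _ hk x hx
    have := G.fil_anti (by omega : G.step + 1 ≤ k) hx
    rw [fil_step_succ, Submodule.mem_bot] at this
    exact ⟨0, this ▸ reach_zero⟩
  | succ j ih =>
    intro k hk1 hk x hx
    obtain ⟨y, hy, z, hz, rfl⟩ := Submodule.mem_sup.1 (G.fil_le_sup k hx)
    obtain ⟨-, C, w, hw, hwy⟩ := layer_le_reachLayer k hk1 hy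
    have hwk : w ∈ G.fil k := by
      have := add_mem (G.fil_anti (Nat.le_succ k) hwy) (G.layer_le_fil le_rfl hy)
      simpa using this
    have h1 : G.mul (-w) (y + z) ∈ G.fil (k + 1) := by
      have := add_mem (G.mul_sub_add_mem_of_mem hk1 (neg_mem hwk) hx) (sub_mem hz hwy)
      convert this using 1
      abel
    obtain ⟨D, hD⟩ := ih (k + 1) (by omega) (by omega) _ h1
    have := hw.mul hD
    rw [G.mul_neg_cancel] at this
    exact ⟨_, this⟩

theorem exists_reach (x : E) : ∃ C, G.Reach C x :=
  exists_reach_of_mem_fil G.step 1 le_rfl (by omega) x (G.mem_fil_one x)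

theorem isClosed_reach (C : ℝ) : IsClosed {x | G.Reach C x} := by
  simp only [Reach, Set.ofPred_forall]
  refine isClosed_iInter fun f => isClosed_iInter fun hf => isClosed_iInter fun p => ?_
  refine isClosed_le ?_ continuous_const
  exact ((hf.1.comp (G.continuous_mul.comp (continuous_const.prodMk continuous_id'))).sub
    continuous_const).abs

/-- By Baire's theorem, a neighbourhood of the neutral element is uniformly reachable. -/
theorem exists_reach_nhds : ∃ C, ∀ᶠ x in 𝓝 (0 : E), G.Reach C x := by
  obtain ⟨n, x, hx⟩ := nonempty_interior_of_iUnion_of_closed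
    (f := fun n : ℕ => {x : E | G.Reach n x}) (fun n => isClosed_reach _) (by
      rw [Set.eq_univ_iff_forall]
      intro x
      obtain ⟨C, hC⟩ := G.exists_reach x
      obtain ⟨n, hn⟩ := exists_nat_ge C
      exact Set.mem_iUnion.2 ⟨n, fun f hf p => (hC f hf p).trans hn⟩)
  have hxr : G.Reach n x := interior_subset hx
  have hc : Filter.Tendsto (G.mul x) (𝓝 0) (𝓝 x) := by
    have h : Continuous (G.mul x) := G.continuous_mul.comp (continuous_const.prodMk continuous_id')
    simpa [G.mul_zero] using h.tendsto 0
  -- If `x` and `x · u` both cost at most `n`, then `u = x⁻¹ · (x · u)` costs at most `2 n`.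
  refine ⟨n + n, ?_⟩
  filter_upwards [hc (mem_interior_iff_mem_nhds.1 hx)] with u hu
  have := hxr.neg.mul (show G.Reach n (G.mul x u) from hu)
  rwa [G.neg_mul_cancel] at this

/-- Cost and `N` both scale by `t` under `δ_t`, so a uniform bound on one small `N`-ball gives a
linear bound everywhere. -/
theorem exists_reach_homogeneousNorm {N : E → ℝ} (hN : G.IsHomogeneousNorm N) :
    ∃ L, ∀ x, G.Reach (L * N x) x := by
  obtain ⟨C, hC⟩ := exists_reach_nhds (G := G)
  obtain ⟨c, hc, hball⟩ := hN.exists_norm_le_one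
  obtain ⟨ε, hε, hεr⟩ : ∃ ε : ℝ, 0 < ε ∧ ∀ x, N x ≤ ε → G.Reach C x := by
    have hcont : Continuous fun p : ℝ × E => G.dilation p.1 p.2 := by
      simp only [CarnotGroup.dilation, LinearMap.sum_apply, LinearMap.smul_apply]
      have h (i : ℕ) : Continuous (G.proj i) := LinearMap.continuous_of_finiteDimensional _
      fun_prop
    have hev : ∀ᶠ t in 𝓝 (0 : ℝ), ∀ x ∈ Metric.closedBall (0 : E) 1, G.Reach C (G.dilation t x) := by
      refine (isCompact_closedBall (0 : E) 1).eventually_forall_of_forall_eventually fun x _ => ?_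
      have : Filter.Tendsto (fun p : ℝ × E => G.dilation p.1 p.2) (𝓝 (0, x)) (𝓝 0) := by
        simpa [dilation_zero] using hcont.tendsto (0, x)
      exact this.eventually hC
    obtain ⟨t, htr, ht0⟩ := ((hev.filter_mono nhdsWithin_le_nhds).and
      (self_mem_nhdsWithin (a := (0 : ℝ)) (s := Set.Ioi (0 : ℝ)))).exists
    replace ht0 : 0 < t := ht0
    -- With this radius `δ_t⁻¹ x` has norm below `c`, hence lies in the unit ball, whose image under
    -- `δ_t` is uniformly reachable.
    refine ⟨t * (c / 2), by positivity, fun x hx => ?_⟩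
    have h1 : N (G.dilation t⁻¹ x) < c := by
      rw [hN.dilation _ (inv_pos.2 ht0), inv_mul_lt_iff₀ ht0]
      nlinarith
    have := htr (G.dilation t⁻¹ x) (by simpa using hball _ h1)
    rwa [G.dilation_dilation_inv ht0.ne'] at this
  refine ⟨C / ε, fun x => ?_⟩
  rcases (hN.nonneg x).eq_or_lt with h0 | hpos
  · rw [← h0, (hN.eq_zero_iff x).1 h0.symm]
    simpa using reach_zero (G := G)
  · have ht : 0 < N x / ε := by positivity
    have h1 : G.Reach C (G.dilation (N x / ε)⁻¹ x) := by
      apply hεr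
      rw [hN.dilation _ (inv_pos.2 ht)]
      apply le_of_eq
      field_simp
    have := h1.dilation ht
    rw [G.dilation_dilation_inv ht.ne'] at this
    convert this using 1
    ring

end CarnotGroup

/-! ### Hausdorff covers, null sets and horizontal segments. -/

theorem le_diamOf {α : Type*} {d : α → α → ℝ} {A : Set α} {p q : α} (hp : p ∈ A) (hq : q ∈ A) :
    ENNReal.ofReal (d p q) ≤ diamOf d A :=
  le_iSup₂_of_le p hp (le_iSup₂_of_le q hq le_rfl)

/-- Covers by small sets that realise a finite Hausdorff measure up to a constant. -/
theorem exists_cover_of_hausdorffOf_lt_top {α : Type*} {d : α → α → ℝ} {s : ℝ} {A : Set α}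
    (hA : hausdorffOf d s A < ∞) : ∃ h < ∞, ∀ r : ℝ≥0∞, 0 < r → ∃ t : ℕ → Set α, A ⊆ ⋃ n, t n ∧
      (∀ n, diamOf d (t n) ≤ r) ∧ ∑' n, ⨆ _ : (t n).Nonempty, diamOf d (t n) ^ s ≤ h := by
  refine ⟨hausdorffOf d s A + 1, ENNReal.add_lt_top.2 ⟨hA, ENNReal.one_lt_top⟩, fun r hr => ?_⟩
  have h1 : (⨅ (t : ℕ → Set α) (_ : A ⊆ ⋃ n, t n) (_ : ∀ n, diamOf d (t n) ≤ r),
      ∑' n, ⨆ _ : (t n).Nonempty, diamOf d (t n) ^ s) < hausdorffOf d s A + 1 :=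
    lt_of_le_of_lt (le_iSup₂_of_le (f := fun (r : ℝ≥0∞) (_ : 0 < r) =>
      ⨅ (t : ℕ → Set α) (_ : A ⊆ ⋃ n, t n) (_ : ∀ n, diamOf d (t n) ≤ r),
      ∑' n, ⨆ _ : (t n).Nonempty, diamOf d (t n) ^ s) r hr le_rfl)
      (ENNReal.lt_add_right hA.ne one_ne_zero)
  simp only [iInf_lt_iff] at h1
  obtain ⟨t, h2, h3, h4⟩ := h1
  exact ⟨t, h2, h3, h4.le⟩

/-- The diameter `D` may be zero, whereas the ball estimates need a positive radius; they are
applied to `r` slightly above `D`. The bound `r ≤ 2` leaves room above `D ≤ 1`. -/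
theorem le_mul_rpow_of_forall_ofReal {F C D : ℝ≥0∞} {s : ℝ} (hC : C ≠ ∞) (hD : D ≤ 1)
    (h : ∀ r : ℝ, 0 < r → r ≤ 2 → D ≤ ENNReal.ofReal r → F ≤ C * ENNReal.ofReal r ^ s) :
    F ≤ C * D ^ s := by
  have hD' : D ≠ ∞ := (hD.trans_lt ENNReal.one_lt_top).ne
  have hd : D.toReal ≤ 1 := by simpa using ENNReal.toReal_mono ENNReal.one_ne_top hD
  have hlim : Filter.Tendsto (fun r : ℝ => C * ENNReal.ofReal r ^ s) (𝓝[>] D.toReal)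
      (𝓝 (C * D ^ s)) := by
    have h1 : Filter.Tendsto (fun r : ℝ => ENNReal.ofReal r ^ s) (𝓝[>] D.toReal)
        (𝓝 (ENNReal.ofReal D.toReal ^ s)) :=
      (((ENNReal.continuous_rpow_const (y := s)).comp ENNReal.continuous_ofReal).tendsto
        _).mono_left nhdsWithin_le_nhds
    rw [ENNReal.ofReal_toReal hD'] at h1
    exact ENNReal.Tendsto.const_mul h1 (Or.inr hC)
  refine ge_of_tendsto hlim ?_
  filter_upwards [Ioc_mem_nhdsGT (show D.toReal < 2 by linarith)] with r hr
  refine h r (lt_of_le_of_lt ENNReal.toReal_nonneg hr.1) hr.2 ?_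
  rw [← ENNReal.ofReal_toReal hD']
  exact ENNReal.ofReal_le_ofReal hr.1.le

namespace CarnotGroup

variable {E : Type*} [NormedAddCommGroup E] [NormedSpace ℝ E] [FiniteDimensional ℝ E]
  {G : CarnotGroup E} {N : E → ℝ}

theorem qdist_le_of_diamOf_le {A : Set E} {r : ℝ} (hr : 0 < r)
    (hA : diamOf (G.qdist N) A ≤ ENNReal.ofReal r) {p q : E} (hp : p ∈ A) (hq : q ∈ A) :
    N (G.mul (-q) p) ≤ r :=
  (ENNReal.ofReal_le_ofReal_iff hr.le).1 ((le_diamOf (d := G.qdist N) hp hq).trans hA)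

variable [MeasurableSpace E] [BorelSpace E] (μ : Measure E) [μ.IsAddHaarMeasure]

theorem IsHomogeneousNorm.exists_measure_le (hN : G.IsHomogeneousNorm N) :
    ∃ C : ℝ≥0∞, C ≠ ∞ ∧ ∀ A : Set E, A.Nonempty → diamOf (G.qdist N) A ≤ 1 →
      μ A ≤ C * diamOf (G.qdist N) A ^ (G.homDim : ℝ) := by
  refine ⟨μ {x | N x ≤ 1}, (hN.isCompact_sublevel 1).measure_lt_top.ne, fun A ⟨a, ha⟩ hA => ?_⟩
  refine le_mul_rpow_of_forall_ofReal (hN.isCompact_sublevel 1).measure_lt_top.ne hA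
    fun r hr _ hr' => ?_
  have hsub : A ⊆ G.mul a '' {x | N x ≤ r} := fun p hp =>
    ⟨G.mul (-a) p, qdist_le_of_diamOf_le hr hr' hp ha, G.mul_neg_cancel a p⟩
  refine (measure_mono hsub).trans ?_
  rw [G.measure_mul_left_image μ a (hN.isCompact_sublevel r).measurableSet,
    hN.measure_sublevel μ hr, ENNReal.rpow_natCast, mul_comm]

/-- The horizontal segments that meet a small set start from a set of small measure. -/
theorem IsHomogeneousNorm.exists_measure_segment_le (hN : G.IsHomogeneousNorm N) {x : E}
    (hx : x ∈ G.layer 1) :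
    ∃ C : ℝ≥0∞, C ≠ ∞ ∧ ∀ A : Set E, A.Nonempty → diamOf (G.qdist N) A ≤ 1 →
      μ {p | ∃ t ∈ Set.Icc (0 : ℝ) 1, G.mul p (t • x) ∈ A}
        ≤ C * diamOf (G.qdist N) A ^ ((G.homDim : ℝ) - 1) := by
  obtain ⟨C₀, hC₀, hmul⟩ := hN.exists_mul_le
  set K := max 1 (N (-x)) with hK
  have hK1 : 1 ≤ K := le_max_left _ _
  have hBfin : μ {x | N x ≤ 1} ≠ ∞ := (hN.isCompact_sublevel 1).measure_lt_top.ne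
  -- The factor `3` bounds `n * r ≤ 1 + r` for `r ≤ 2`. Below, `Q` is the homogeneous dimension
  -- minus one.
  set C : ℝ≥0∞ := ENNReal.ofReal 3 * ENNReal.ofReal (C₀ * K) ^ G.homDim * μ {x | N x ≤ 1} with hC
  have hCfin : C ≠ ∞ := ENNReal.mul_ne_top (ENNReal.mul_ne_top ENNReal.ofReal_ne_top
    (ENNReal.pow_ne_top ENNReal.ofReal_ne_top)) hBfin
  obtain ⟨Q, hQ⟩ : ∃ Q, G.homDim = Q + 1 := ⟨G.homDim - 1, by have := G.one_le_homDim; omega⟩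
  have hQ' : (G.homDim : ℝ) - 1 = Q := by rw [hQ]; push_cast; ring
  refine ⟨C, hCfin, fun A ⟨a, ha⟩ hA => ?_⟩
  rw [hQ']
  refine le_mul_rpow_of_forall_ofReal hCfin hA fun r hr hr2 hr' => ?_
  set B : Set E := {y | N y ≤ C₀ * K * r} with hB
  have hBm : MeasurableSet B := (hN.isCompact_sublevel _).measurableSet
  have hBm' : MeasurableSet (G.mul a '' B) :=
    ((hN.isCompact_sublevel _).image
      (G.continuous_mul.comp (continuous_const.prodMk continuous_id'))).measurableSet
  set n := ⌊1 / r⌋₊ + 1 with hn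
  -- Round the hitting time `t` down to a multiple `j * r`. Moving back along the segment by less
  -- than `r` costs at most `N (-x) * r`, so `p · (j r) x` stays in a ball about `a` of radius
  -- comparable to `r`, and `p` lies in one of `n` right translates of that ball.
  have hsub : {p | ∃ t ∈ Set.Icc (0 : ℝ) 1, G.mul p (t • x) ∈ A}
      ⊆ ⋃ j ∈ Finset.range n, (fun y => G.mul y ((-(j * r)) • x)) '' (G.mul a '' B) := by
    rintro p ⟨t, ht, hp⟩
    have htr : 0 ≤ t / r := div_nonneg ht.1 hr.le
    set j := ⌊t / r⌋₊ with hj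
    have hjn : j < n := Nat.lt_succ_of_le (Nat.floor_le_floor (by gcongr; exact ht.2))
    have hs0 : 0 ≤ t - j * r := by
      have := Nat.floor_le htr
      rw [← hj, le_div_iff₀ hr] at this
      linarith
    have hs1 : t - j * r ≤ r := by
      have := Nat.lt_floor_add_one (t / r)
      rw [← hj, div_lt_iff₀ hr] at this
      linarith
    simp only [Set.mem_iUnion, Finset.mem_range]
    refine ⟨j, hjn, G.mul (G.mul p (t • x)) ((-(t - j * r)) • x), ?_, ?_⟩
    · refine ⟨G.mul (G.mul (-a) (G.mul p (t • x))) ((-(t - j * r)) • x), ?_, ?_⟩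
      · have h1 : N (G.mul (-a) (G.mul p (t • x))) ≤ r := qdist_le_of_diamOf_le hr hr' hp ha
        have h2 : N ((-(t - j * r)) • x) ≤ K * r := by
          rw [neg_smul, ← smul_neg, ← G.dilation_of_mem_layer_one (neg_mem hx), hN.dilation' hs0,
            mul_comm]
          exact mul_le_mul (le_max_right _ _) hs1 hs0 (by positivity)
        have h3 : N (G.mul (-a) (G.mul p (t • x))) ≤ K * r := h1.trans (by nlinarith)
        have := hmul _ _ _ h3 h2
        rw [hB, Set.mem_ofPred_eq]
        linarith
      · rw [← G.mul_assoc, G.mul_neg_cancel]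
    · simp only [G.mul_assoc, G.mul_smul_smul]
      rw [show t + -(t - j * r) + -(j * r) = 0 by ring, zero_smul, G.mul_zero]
  have hμB : μ B = ENNReal.ofReal (C₀ * K) ^ G.homDim * ENNReal.ofReal r ^ (Q + 1)
      * μ {x | N x ≤ 1} := by
    rw [hB, hN.measure_sublevel μ (by positivity), ENNReal.ofReal_mul (by positivity), mul_pow, hQ]
  have hnr : (n : ℝ≥0∞) * ENNReal.ofReal r ≤ ENNReal.ofReal 3 := by
    rw [← ENNReal.ofReal_natCast, ← ENNReal.ofReal_mul (by positivity)]
    refine ENNReal.ofReal_le_ofReal ?_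
    have h1 := Nat.floor_le (show 0 ≤ 1 / r by positivity)
    rw [le_div_iff₀ hr] at h1
    rw [hn]
    push_cast
    linarith
  calc μ {p | ∃ t ∈ Set.Icc (0 : ℝ) 1, G.mul p (t • x) ∈ A}
      ≤ ∑ j ∈ Finset.range n, μ ((fun y => G.mul y ((-(j * r)) • x)) '' (G.mul a '' B)) :=
        (measure_mono hsub).trans (measure_biUnion_finset_le _ _)
    _ = n * μ B := by
        rw [Finset.sum_congr rfl fun j _ => (G.measure_mul_right_image μ _ hBm').trans
          (G.measure_mul_left_image μ a hBm)]
        simp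
    _ = (n * ENNReal.ofReal r) * (ENNReal.ofReal (C₀ * K) ^ G.homDim * μ {x | N x ≤ 1}
          * ENNReal.ofReal r ^ Q) := by rw [hμB]; ring
    _ ≤ ENNReal.ofReal 3 * (ENNReal.ofReal (C₀ * K) ^ G.homDim * μ {x | N x ≤ 1}
          * ENNReal.ofReal r ^ Q) := by gcongr
    _ = C * ENNReal.ofReal r ^ (Q : ℝ) := by rw [hC, ENNReal.rpow_natCast]; ring

/-- A set of diameter at most `r` has measure at most `C * r` times the `(Q - 1)`-th power of its
diameter. The sums of these powers stay bounded while `r` tends to `0`. -/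
theorem IsHomogeneousNorm.measure_eq_zero (hN : G.IsHomogeneousNorm N) {A : Set E}
    (hA : hausdorffOf (G.qdist N) ((G.homDim : ℝ) - 1) A < ∞) : μ A = 0 := by
  obtain ⟨h, hh, hcov⟩ := exists_cover_of_hausdorffOf_lt_top hA
  obtain ⟨C, hC, hμ⟩ := hN.exists_measure_le μ
  obtain ⟨Q, hQ⟩ : ∃ Q, G.homDim = Q + 1 := ⟨G.homDim - 1, by have := G.one_le_homDim; omega⟩
  have hQ' : (G.homDim : ℝ) - 1 = Q := by rw [hQ]; push_cast; ring
  have key : ∀ r : ℝ≥0∞, 0 < r → r ≤ 1 → μ A ≤ C * h * r := by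
    intro r hr hr1
    obtain ⟨t, h1, h2, h3⟩ := hcov r hr
    have h4 : ∀ n, μ (t n) ≤ C * r * ⨆ _ : (t n).Nonempty,
        diamOf (G.qdist N) (t n) ^ ((G.homDim : ℝ) - 1) := by
      intro n
      by_cases hne : (t n).Nonempty
      · refine (hμ _ hne ((h2 n).trans hr1)).trans ?_
        simp only [hne, iSup_pos, hQ']
        rw [hQ, ENNReal.rpow_natCast, ENNReal.rpow_natCast, pow_succ', _root_.mul_assoc]
        gcongr
        exact h2 n
      · simp [Set.not_nonempty_iff_eq_empty.1 hne]
    calc μ A ≤ ∑' n, μ (t n) := (measure_mono h1).trans (measure_iUnion_le _)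
      _ ≤ ∑' n, C * r * ⨆ _ : (t n).Nonempty,
          diamOf (G.qdist N) (t n) ^ ((G.homDim : ℝ) - 1) := ENNReal.tsum_le_tsum h4
      _ ≤ C * r * h := by rw [ENNReal.tsum_mul_left]; gcongr
      _ = C * h * r := by ring
  have hlim : Filter.Tendsto (fun n : ℕ => C * h * (n : ℝ≥0∞)⁻¹) Filter.atTop (𝓝 (C * h * 0)) :=
    ENNReal.Tendsto.const_mul ENNReal.tendsto_inv_nat_nhds_zero
      (Or.inr (ENNReal.mul_ne_top hC hh.ne))
  rw [MulZeroClass.mul_zero] at hlim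
  refine le_antisymm (ge_of_tendsto hlim ?_) (zero_le)
  filter_upwards [Filter.eventually_ge_atTop 1] with n hn
  exact key _ (by simp) (by simpa using hn)

/-- Almost every horizontal segment meets a set of finite `(Q - 1)`-dimensional measure in a finite
set. -/
theorem IsHomogeneousNorm.ae_finite_segment (hN : G.IsHomogeneousNorm N) {x : E}
    (hx : x ∈ G.layer 1) (hx0 : x ≠ 0) {A : Set E}
    (hA : hausdorffOf (G.qdist N) ((G.homDim : ℝ) - 1) A < ∞) :
    ∀ᵐ p ∂μ, {t ∈ Set.Icc (0 : ℝ) 1 | G.mul p (t • x) ∈ A}.Finite := by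
  classical
  obtain ⟨h, hh, hcov⟩ := exists_cover_of_hausdorffOf_lt_top hA
  obtain ⟨C, hC, hμ⟩ := hN.exists_measure_segment_le μ hx
  have hr0 : ∀ k : ℕ, (0 : ℝ≥0∞) < ((k + 1 : ℕ) : ℝ≥0∞)⁻¹ := fun k => by simp
  choose t h1 h2 h3 using fun k : ℕ => hcov _ (hr0 k)
  -- The function `g k` dominates the number of sets of the `k`-th cover met by the segment from
  -- `p`. Measurable hulls are taken because the covering sets are arbitrary.
  let P : Set E → Set E := fun A => {p | ∃ t ∈ Set.Icc (0 : ℝ) 1, G.mul p (t • x) ∈ A}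
  let T : ℕ → ℕ → Set E := fun k n => toMeasurable μ (P (t k n))
  let g : ℕ → E → ℝ≥0∞ := fun k p => ∑' n, (T k n).indicator 1 p
  have hgm : ∀ k, Measurable (g k) := fun k =>
    Measurable.tsum fun n => measurable_one.indicator (measurableSet_toMeasurable _ _)
  have hgint : ∀ k, ∫⁻ p, g k p ∂μ ≤ C * h := by
    intro k
    have h4 : ∀ n, μ (P (t k n)) ≤ C * ⨆ _ : (t k n).Nonempty,
        diamOf (G.qdist N) (t k n) ^ ((G.homDim : ℝ) - 1) := by
      intro n
      by_cases hne : (t k n).Nonempty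
      · have hd : diamOf (G.qdist N) (t k n) ≤ 1 := (h2 k n).trans (by simp)
        simpa only [hne, iSup_pos] using hμ _ hne hd
      · simp [P, Set.not_nonempty_iff_eq_empty.1 hne]
    calc ∫⁻ p, g k p ∂μ = ∑' n, μ (P (t k n)) := by
          rw [lintegral_tsum fun n =>
            (measurable_one.indicator (measurableSet_toMeasurable _ _)).aemeasurable]
          refine tsum_congr fun n => ?_
          rw [lintegral_indicator_one (measurableSet_toMeasurable _ _), measure_toMeasurable]
      _ ≤ ∑' n, C * ⨆ _ : (t k n).Nonempty,
          diamOf (G.qdist N) (t k n) ^ ((G.homDim : ℝ) - 1) := ENNReal.tsum_le_tsum h4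
      _ ≤ C * h := by rw [ENNReal.tsum_mul_left]; gcongr; exact h3 k
  -- Fatou's lemma: the integrals of `g k` are bounded uniformly in `k`.
  have hliminf : ∫⁻ p, Filter.liminf (fun k => g k p) Filter.atTop ∂μ ≠ ∞ := by
    refine ne_of_lt ((lintegral_liminf_le hgm).trans_lt ?_)
    refine lt_of_le_of_lt ?_ (ENNReal.mul_lt_top hC.lt_top hh)
    refine (Filter.liminf_le_liminf (Filter.Eventually.of_forall hgint)).trans_eq ?_
    exact Filter.liminf_const _
  have hae := ae_lt_top (Measurable.liminf hgm) hliminf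
  filter_upwards [hae] with p hp
  by_contra hinf
  have hinf' : {t ∈ Set.Icc (0 : ℝ) 1 | G.mul p (t • x) ∈ A}.Infinite := hinf
  refine hp.ne (ENNReal.eq_top_of_forall_nnreal_le fun c => ?_)
  obtain ⟨j, hj⟩ := exists_nat_ge c
  have hcj : (c : ℝ≥0∞) ≤ j := by exact_mod_cast hj
  refine hcj.trans (Filter.le_liminf_of_le (by isBoundedDefault) ?_)
  -- Once the covering sets are smaller than the mutual distances of `j` chosen hits, these hits lie
  -- in distinct sets, so `g k p` is at least `j`.
  obtain ⟨F, hF, hFc⟩ := hinf'.exists_subset_card_eq j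
  have hsep : ∀ᶠ k : ℕ in Filter.atTop, ∀ s ∈ F, ∀ s' ∈ F, s ≠ s' →
      ((k + 1 : ℕ) : ℝ≥0∞)⁻¹ < ENNReal.ofReal (G.qdist N (G.mul p (s • x)) (G.mul p (s' • x))) := by
    rw [Filter.eventually_all_finset]
    intro s _
    rw [Filter.eventually_all_finset]
    intro s' _
    by_cases hss : s = s'
    · simp [hss]
    · have hpos : 0 < G.qdist N (G.mul p (s • x)) (G.mul p (s' • x)) := by
        rw [qdist, G.neg_mul_rev, G.mul_assoc, G.neg_mul_cancel, ← neg_smul, G.mul_smul_smul]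
        refine hN.pos (smul_ne_zero ?_ hx0)
        intro h0
        exact hss (by linarith)
      have hlim := (Filter.tendsto_add_atTop_iff_nat 1).2 ENNReal.tendsto_inv_nat_nhds_zero
      filter_upwards [hlim.eventually_lt_const (ENNReal.ofReal_pos.2 hpos)] with k hk _
      exact hk
  filter_upwards [hsep] with k hk
  have hn : ∀ s : ℝ, ∃ n, s ∈ F → G.mul p (s • x) ∈ t k n := by
    intro s
    by_cases hs : s ∈ F
    · obtain ⟨n, hn⟩ := Set.mem_iUnion.1 (h1 k (hF hs).2)
      exact ⟨n, fun _ => hn⟩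
    · exact ⟨0, fun h => absurd h hs⟩
  choose ν hν using hn
  have hinj : Set.InjOn ν F := by
    intro s hs s' hs' hss
    by_contra hne
    refine absurd ((hk s hs s' hs' hne).trans_le ?_) (lt_irrefl _)
    refine (le_diamOf (hν s hs) ?_).trans (h2 k (ν s))
    rw [hss]
    exact hν s' hs'
  calc (j : ℝ≥0∞) = ∑ n ∈ F.image ν, (T k n).indicator 1 p := by
        rw [Finset.sum_image hinj, ← hFc, Finset.card_eq_sum_ones, Nat.cast_sum]
        refine Finset.sum_congr rfl fun s hs => ?_
        have : p ∈ T k (ν s) := subset_toMeasurable _ _ ⟨s, (hF hs).1, hν s hs⟩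
        simp [Set.indicator_of_mem this]
    _ ≤ g k p := ENNReal.sum_le_tsum _

end CarnotGroup

/-! ### Calculus along horizontal segments. -/

namespace CarnotGroup

variable {E : Type*} [NormedAddCommGroup E] [NormedSpace ℝ E] [FiniteDimensional ℝ E]
  {G : CarnotGroup E} {N : E → ℝ}

theorem hasDerivAt_comp_mul_smul {f : E → ℝ} {p : E} (hf : DifferentiableAt ℝ f p) (x : E) :
    HasDerivAt (fun t : ℝ => f (G.mul p (t • x))) (fderiv ℝ f p (G.psi (G.expAd p) x)) 0 := by
  have h1 := G.hasDerivAt_mul_smul p x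
  have h2 : HasFDerivAt f (fderiv ℝ f p) (G.mul p ((0 : ℝ) • x)) := by
    rw [zero_smul, G.mul_zero]; exact hf.hasFDerivAt
  exact h2.comp_hasDerivAt (0 : ℝ) h1

theorem leftDeriv_eq {f : E → ℝ} {p : E} (hf : DifferentiableAt ℝ f p) (x : E) :
    G.leftDeriv f x p = fderiv ℝ f p (G.psi (G.expAd p) x) :=
  (hasDerivAt_comp_mul_smul hf x).deriv

theorem hasDerivAt_segment {f : E → ℝ} {p x : E} {t : ℝ}
    (hf : DifferentiableAt ℝ f (G.mul p (t • x))) :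
    HasDerivAt (fun s : ℝ => f (G.mul p (s • x))) (G.leftDeriv f x (G.mul p (t • x))) t := by
  rw [leftDeriv_eq hf]
  have h1 := hasDerivAt_comp_mul_smul (G := G) hf x
  have h2 : (fun s : ℝ => f (G.mul p (s • x)))
      = fun s => (fun r : ℝ => f (G.mul (G.mul p (t • x)) (r • x))) (s - t) := by
    funext s
    simp only [G.mul_assoc, G.mul_smul_smul, add_sub_cancel]
  rw [h2]
  rw [← sub_self t] at h1
  exact h1.comp_sub_const t t

variable [MeasurableSpace E] [BorelSpace E] (μ : Measure E) [μ.IsAddHaarMeasure]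

/-- Countably many of the given neighbourhoods cover `E`, and each contributes finitely many hits.
Countability is all that the fundamental theorem of calculus requires. -/
theorem IsHomogeneousNorm.ae_countable_segment (hN : G.IsHomogeneousNorm N) {S : Set E}
    (hS : ∀ p : E, ∃ U ∈ 𝓝 p, hausdorffOf (G.qdist N) ((G.homDim : ℝ) - 1) (S ∩ U) < ∞)
    {x : E} (hx : x ∈ G.layer 1) (hx0 : x ≠ 0) :
    ∀ᵐ p ∂μ, {t ∈ Set.Icc (0 : ℝ) 1 | G.mul p (t • x) ∈ S}.Countable := by
  choose U hU hUS using hS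
  obtain ⟨c, hc, hcU⟩ := TopologicalSpace.countable_cover_nhds hU
  have h := (ae_ball_iff hc).2 fun i _ => hN.ae_finite_segment μ hx hx0 (hUS i)
  filter_upwards [h] with p hp
  refine (hc.biUnion fun i hi => (hp i hi).countable).mono ?_
  intro t ht
  have : G.mul p (t • x) ∈ ⋃ i ∈ c, U i := by rw [hcU]; trivial
  simp only [Set.mem_iUnion] at this ⊢
  obtain ⟨i, hi, hiU⟩ := this
  exact ⟨i, hi, ht.1, ht.2, hiU⟩

theorem IsHomogeneousNorm.measure_eq_zero_of_locally (hN : G.IsHomogeneousNorm N) {S : Set E}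
    (hS : ∀ p : E, ∃ U ∈ 𝓝 p, hausdorffOf (G.qdist N) ((G.homDim : ℝ) - 1) (S ∩ U) < ∞) :
    μ S = 0 := by
  refine measure_null_of_locally_null S fun p _ => ?_
  obtain ⟨U, hU, hUS⟩ := hS p
  exact ⟨S ∩ U, Filter.inter_mem self_mem_nhdsWithin (mem_nhdsWithin_of_mem_nhds hU),
    hN.measure_eq_zero μ hUS⟩

/-- A continuous function whose derivative in a horizontal direction is bounded off a set of locally
finite `(Q - 1)`-dimensional measure is Lipschitz in that direction. -/
theorem IsHomogeneousNorm.abs_sub_le_of_leftDeriv (hN : G.IsHomogeneousNorm N) {S : Set E}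
    (hS : ∀ p : E, ∃ U ∈ 𝓝 p, hausdorffOf (G.qdist N) ((G.homDim : ℝ) - 1) (S ∩ U) < ∞)
    {f : E → ℝ} (hf : Continuous f) (hd : ∀ p ∉ S, DifferentiableAt ℝ f p) {x : E}
    (hx : x ∈ G.layer 1) {K : ℝ} (hK : 0 ≤ K) (hb : ∀ p ∉ S, |G.leftDeriv f x p| ≤ K) (p : E) :
    |f (G.mul p x) - f p| ≤ K := by
  let μ : Measure E := Measure.addHaar
  rcases eq_or_ne x 0 with rfl | hx0
  · simpa [G.mul_zero] using hK
  have hae : ∀ᵐ p ∂μ, |f (G.mul p x) - f p| ≤ K := by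
    filter_upwards [hN.ae_countable_segment μ hS hx hx0] with p hp
    set u : ℝ → ℝ := fun t => f (G.mul p (t • x)) with hu
    have huc : Continuous u :=
      hf.comp (G.continuous_mul.comp (continuous_const.prodMk (by fun_prop)))
    have hud : ∀ t ∈ Set.Icc (0 : ℝ) 1 \ {t ∈ Set.Icc (0 : ℝ) 1 | G.mul p (t • x) ∈ S},
        HasDerivAt u (deriv u t) t ∧ ‖deriv u t‖ ≤ K := by
      rintro t ⟨ht, hts⟩
      have hq : G.mul p (t • x) ∉ S := fun h => hts ⟨ht, h⟩
      have h := hasDerivAt_segment (hd _ hq)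
      rw [h.deriv]
      exact ⟨h, hb _ hq⟩
    have hbd : ∀ᵐ t : ℝ, t ∈ Set.uIoc (0 : ℝ) 1 → ‖deriv u t‖ ≤ K := by
      filter_upwards [hp.ae_notMem volume] with t ht htI
      rw [Set.uIoc_of_le zero_le_one] at htI
      exact (hud t ⟨Set.Ioc_subset_Icc_self htI, ht⟩).2
    have hint : IntervalIntegrable (deriv u) volume 0 1 := by
      rw [intervalIntegrable_iff]
      refine Measure.integrableOn_of_bounded (M := K) (by simp) (measurable_deriv u).aestronglyMeasurable ?_
      exact (ae_restrict_iff' measurableSet_uIoc).2 hbd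
    have h1 := integral_eq_of_hasDerivAt_off_countable u (deriv u) hp huc.continuousOn
      (fun t ht => (hud t ⟨by
        have := ht.1
        simp only [zero_le_one, inf_of_le_left, sup_of_le_right] at this
        exact Set.Ioo_subset_Icc_self this, ht.2⟩).1) hint
    have h2 := intervalIntegral.norm_integral_le_of_norm_le_const_ae hbd
    rw [h1] at h2
    simpa [hu, G.mul_zero] using h2
  -- A closed set of full measure is the whole space, since full measure makes it dense.
  have hcl : IsClosed {p | |f (G.mul p x) - f p| ≤ K} :=
    isClosed_le ((hf.comp (G.continuous_mul.comp (continuous_id'.prodMk continuous_const))).sub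
      hf).abs continuous_const
  have := (Measure.dense_of_ae hae).closure_eq
  rw [hcl.closure_eq] at this
  exact Set.eq_univ_iff_forall.1 this p

/-- The left-invariant field of `x` is `q ↦ ψ (exp (ad q)) x`, which is continuous. This is what
allows an almost everywhere gradient bound to hold at every point off `S`. -/
theorem continuousAt_leftDeriv {f : E → ℝ} {p : E} (hf : ContDiffAt ℝ 1 f p) (x : E) :
    ContinuousAt (G.leftDeriv f x) p := by
  have h1 : Continuous fun q : E => G.psi (G.expAd q) x := by
    have := G.continuous_psi_expAd (T := E) (g := fun q => q) (h := fun _ => (0 : ℝ) • x)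
      (k := fun _ => x) continuous_id' continuous_const continuous_const
    have h0 : ∀ q, G.expAd q * G.expAd ((0 : ℝ) • x) = G.expAd q := fun q => by
      rw [zero_smul, expAd_zero, mul_one]
    simpa only [h0] using this
  have h2 : ContinuousAt (fun q => fderiv ℝ f q (G.psi (G.expAd q) x)) p :=
    (hf.continuousAt_fderiv one_ne_zero).clm_apply h1.continuousAt
  refine h2.congr ?_
  filter_upwards [hf.eventually (by simp)] with q hq
  exact (leftDeriv_eq (hq.differentiableAt one_ne_zero) x).symm

theorem leftDeriv_sum_smul {f : E → ℝ} {p : E} (hf : DifferentiableAt ℝ f p) {ι : Type*}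
    (s : Finset ι) (c : ι → ℝ) (x : ι → E) :
    G.leftDeriv f (∑ i ∈ s, c i • x i) p = ∑ i ∈ s, c i * G.leftDeriv f (x i) p := by
  simp only [leftDeriv_eq hf, map_sum, map_smul, smul_eq_mul]

/-- A bound for the horizontal gradient bounds the derivatives in all horizontal directions. -/
theorem exists_leftDeriv_le {m : ℕ} (X : Module.Basis (Fin m) ℝ (G.layer 1)) :
    ∃ C : ℝ, 0 ≤ C ∧ ∀ (f : E → ℝ) (p : E), DifferentiableAt ℝ f p → ∀ x ∈ G.layer 1,
      |G.leftDeriv f x p| ≤ C * ‖G.horizGrad X f p‖ * ‖x‖ := by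
  let c : Fin m → G.layer 1 →L[ℝ] ℝ := fun j => LinearMap.toContinuousLinearMap (X.coord j)
  -- One factor `‖c j‖` extracts `Xⱼ f` from the gradient, the other bounds the `j`-th coordinate of
  -- `x`.
  refine ⟨∑ j, ‖c j‖ * ‖c j‖, by positivity, fun f p hf x hx => ?_⟩
  have h1 : ∀ j, |G.leftDeriv f (X j : E) p| ≤ ‖c j‖ * ‖G.horizGrad X f p‖ := by
    intro j
    let v : G.layer 1 := ∑ j, G.leftDeriv f (X j : E) p • X j
    have hv : (v : E) = G.horizGrad X f p := by simp [v, horizGrad]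
    have hcv : c j v = G.leftDeriv f (X j : E) p := by
      simp [c, v, Finsupp.single_apply]
    rw [← hcv, ← hv]
    exact (c j).le_opNorm v
  have h2 : x = ∑ j, c j ⟨x, hx⟩ • (X j : E) := by
    have := congrArg (G.layer 1).subtype (X.sum_repr ⟨x, hx⟩)
    rw [map_sum] at this
    exact this.symm
  conv_lhs => rw [h2, leftDeriv_sum_smul hf]
  rw [Finset.sum_mul, Finset.sum_mul]
  refine (Finset.abs_sum_le_sum_abs _ _).trans (Finset.sum_le_sum fun j _ => ?_)
  rw [abs_mul]
  have h3 : |c j ⟨x, hx⟩| ≤ ‖c j‖ * ‖x‖ := (c j).le_opNorm ⟨x, hx⟩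
  calc |c j ⟨x, hx⟩| * |G.leftDeriv f (X j : E) p|
      ≤ (‖c j‖ * ‖x‖) * (‖c j‖ * ‖G.horizGrad X f p‖) := by gcongr; exact h1 j
    _ = _ := by ring

end CarnotGroup

end

theorem lemma5p4 {E : Type*} [NormedAddCommGroup E] [NormedSpace ℝ E] [FiniteDimensional ℝ E]
    [MeasurableSpace E] [BorelSpace E]
    (G : CarnotGroup E)
    (N : E → ℝ) (hN : G.IsHomogeneousNorm N)
    {m : ℕ} (X : Module.Basis (Fin m) ℝ (G.layer 1))
    (μ : Measure E) [μ.IsAddHaarMeasure]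
    (S : Set E)
    (hS : ∀ p : E, ∃ U ∈ 𝓝 p, hausdorffOf (G.qdist N) ((G.homDim : ℝ) - 1) (S ∩ U) < ∞)
    (f : E → ℝ) (hf : Continuous f)
    (hC1 : ∀ p, p ∉ S → ContDiffAt ℝ 1 f p)
    (hgrad : ∃ M : ℝ, ∀ᵐ p ∂μ, p ∉ S → ‖G.horizGrad X f p‖ ≤ M) :
    ∃ L : ℝ, ∀ p q : E, |f p - f q| ≤ L * G.qdist N p q := by
  obtain ⟨M, hM⟩ := hgrad
  obtain ⟨C, hC0, hC⟩ := CarnotGroup.exists_leftDeriv_le X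
  obtain ⟨L, hL⟩ := CarnotGroup.exists_reach_homogeneousNorm hN
  have hS0 := measure_eq_zero_iff_ae_notMem.1 (hN.measure_eq_zero_of_locally μ hS)
  have hdense : Dense {p | ‖G.horizGrad X f p‖ ≤ M} := Measure.dense_of_ae (μ := μ) (by
    filter_upwards [hM, hS0] with p h1 h2 using h1 h2)
  -- The gradient is continuous at points off `S`, so a value above `M` would persist on a
  -- neighbourhood and contradict density.
  have hbound : ∀ p ∉ S, ‖G.horizGrad X f p‖ ≤ M := by
    intro p hp
    by_contra! h
    have hcont : ContinuousAt (G.horizGrad X f) p :=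
      tendsto_finsetSum _ fun j _ =>
        (CarnotGroup.continuousAt_leftDeriv (hC1 p hp) (X j : E)).smul continuousAt_const
    obtain ⟨q, hq1, hq2⟩ := (mem_closure_iff_nhds.1 (hdense p)) _
      (hcont.norm.eventually (lt_mem_nhds h))
    exact not_le.2 (show M < ‖G.horizGrad X f q‖ from hq1) hq2
  -- The summand `1` makes `K` positive, so that `K⁻¹ * f` is an admissible test function for
  -- `Reach`.
  set K : ℝ := C * |M| + 1 with hK
  have hK0 : 0 < K := by positivity
  have hlip : G.IsHorizLipschitz fun p => K⁻¹ * f p := by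
    refine ⟨hf.const_mul _, fun x hx p => ?_⟩
    rw [← mul_sub, abs_mul, abs_of_pos (inv_pos.2 hK0), inv_mul_le_iff₀ hK0]
    refine hN.abs_sub_le_of_leftDeriv hS hf
      (fun p hp => (hC1 p hp).differentiableAt one_ne_zero) hx (by positivity) (fun q hq => ?_) p
    refine (hC f q ((hC1 q hq).differentiableAt one_ne_zero) x hx).trans ?_
    gcongr
    have h1 := (hbound q hq).trans (le_abs_self M)
    calc C * ‖G.horizGrad X f q‖ ≤ C * |M| := by gcongr
      _ ≤ K := by rw [hK]; linarith
  refine ⟨K * L, fun p q => ?_⟩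
  -- Starting from `q`, right translation by `q⁻¹ · p` arrives at `p`.
  have h := hL (G.mul (-q) p) _ hlip q
  rw [G.mul_neg_cancel, ← mul_sub, abs_mul, abs_of_pos (inv_pos.2 hK0), inv_mul_le_iff₀ hK0] at h
  rw [CarnotGroup.qdist, mul_assoc]
  exact h
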